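/- Let $p\ge 2$ be an even integer. **Trace maps.** A $p$-regular trace map $\mathfrak b=(\pi,\alpha)$ is a pair of permutations of a finite set of half-edges, where all cycles of $\pi$ (the vertices) have length $p$ and $\alpha$ is an involution without fixed points (its 2-cycles are the edges). Two maps $(\pi,\alpha'),(\pi,\alpha)$ differ by a switch if $\alpha'$ is obtained from $\alpha$ by exchanging an end point of one edge with an end point of another edge; the non-crossing order $\le$ on the maps with given $\pi$ is generated by the relations $\mathfrak b'<\mathfrak b$ whenever $\mathfrak b',\mathfrak b$ differ by a switch and $\mathfrak b'$ has exactly one more connected component than $\mathfrak b$. **Distributions.** A (joint) distribution of a family $(a_i)_{i\in I}$ of elements of order $p$ assigns a real number to every $p$-regular trace map whose vertices are decorated by members of the family; it is invariant under isomorphism of decorated maps, multiplicative over disjoint unions, and equal to $1$ on the empty map. The distribution of $\sum_i a_i$ ($I$ finite) is given by multilinearity: its value on $\mathfrak b$ is the sum of the values of $\mathfrak b$ over all decorations of its vertices. The free cumulants $\kappa_{\mathfrak b}$ are defined, for each fixed decoration, by $\mathfrak b(\cdot)=\sum_{\mathfrak b'\le\mathfrak b}\kappa_{\mathfrak b'}(\cdot)$,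 and the family is free if $\kappa_{\mathfrak b}=0$ for every connected $\mathfrak b$ decorated with at least two different members. For a single element $a$ let $m_0(a)=1$ and, for $n\ge1$, let $m_n(a)$ be the sum of $a(\mathfrak b)$ over all connected rooted (one marked half-edge) $p$-regular trace maps $\mathfrak b$ with $n$ unlabelled vertices. A measure $\mu$ on $\mathbb R$ is the law of $a$ if all its moments are finite and $\int x^n\,d\mu=m_n(a)$ for all $n\ge 0$. **Free convolution.** Let $\mu,\nu$ be compactly supported probability measures on $\mathbb R$ such that there are free elements $a,b$ with laws $\mu,\nu$. The tensorial free convolution $\mu\oplus_p\nu$ is the compactly supported probability measure which is the law of $a+b$ for every such free pair $(a,b)$. **Semicircular law.** $\mu_p$ is the compactly supported probability measure on $\mathbb R$ with $\int x^{n}\,d\mu_p=0$ for odd $n$ and $\int x^{2k}\,d\mu_p=\frac{1}{pk+1}\binom{pk+1}{k}$ for $k\ge0$. **Statement.** For every even $p\ge2$ the measure $\mu_p$ exists and is unique, the tensorial free convolution $\mu_p\oplus_p\mu_p$ exists and is unique, and $$\mu_p\oplus_p\mu_p=\mu_p^{(\sqrt2)},$$ where $\mu_p^{(\sqrt2)}$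 is the image of $\mu_p$ under $x\mapsto\sqrt2\,x$. -/

import Mathlib

open MeasureTheory

noncomputable section

namespace TensorFree

/-- A (labelled) `p`-regular trace map with vertex set `V`. The half-edges are the pairs `(v, i)`
with `v : V` and `i : Fin p`; the cycle of the vertex permutation at `v` is
`(v, 0) ↦ (v, 1) ↦ ⋯ ↦ (v, p - 1) ↦ (v, 0)`, see `rot`. The edges are the 2-cycles of a
fixed-point-free involution of the half-edges. -/
@[ext]
structure TraceMap (p : ℕ) (V : Type) where
  edge : Equiv.Perm (V × Fin p)
  edge_edge : ∀ h, edge (edge h) = h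
  edge_ne : ∀ h, edge h ≠ h

/-- The vertex permutation: next half-edge around the same vertex. -/
def rot (p : ℕ) (V : Type) : Equiv.Perm (V × Fin p) :=
  Equiv.prodCongr (Equiv.refl V) (finRotate p)

namespace TraceMap

variable {p : ℕ} {V W : Type}

instance [Finite V] : Finite (TraceMap p V) :=
  Finite.of_injective TraceMap.edge fun _ _ h => TraceMap.ext h

/-- The simple graph underlying a trace map; it has the same connected components. -/
def graph (b : TraceMap p V) : SimpleGraph V :=
  SimpleGraph.fromRel fun v w => ∃ i j, b.edge (v, i) = (w, j)

/-- A trace map is connected if it is non-empty and any two vertices are joined by a path. -/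
def IsConnected (b : TraceMap p V) : Prop := b.graph.Connected

/-- The number of connected components. -/
def numComponents (b : TraceMap p V) : ℕ := Nat.card b.graph.ConnectedComponent

open Classical in
/-- `b'` and `b` differ by a switch: the end points `x` and `y` of two distinct edges
`{x, α x}` and `{y, α y}` of `b` are exchanged, giving the edges `{y, α x}` and `{x, α y}`. -/
def IsSwitch (b' b : TraceMap p V) : Prop :=
  ∃ x y, x ≠ y ∧ b.edge x ≠ y ∧ b'.edge = Equiv.swap x y * b.edge * Equiv.swap x y

/-- An elementary step down: a switch that creates one more connected component. -/
def StepDown (b' b : TraceMap p V) : Prop :=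
  IsSwitch b' b ∧ b'.numComponents = b.numComponents + 1

theorem numComponents_lt_of_transGen {b' b : TraceMap p V} (h : Relation.TransGen StepDown b' b) :
    b.numComponents < b'.numComponents := by
  induction h with
  | single h => have := h.2; omega
  | tail _ h ih => have := h.2; omega

/-- The non-crossing order on the trace maps with a given vertex permutation: the reflexive and
transitive closure of `StepDown`. -/
instance : PartialOrder (TraceMap p V) where
  le := Relation.ReflTransGen StepDown
  lt := Relation.TransGen StepDown
  le_refl _ := Relation.ReflTransGen.refl
  le_trans _ _ _ := Relation.ReflTransGen.trans
  le_antisymm a b hab hba := by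
    rcases Relation.reflTransGen_iff_eq_or_transGen.1 hab with h | h
    · exact h.symm
    · rcases Relation.reflTransGen_iff_eq_or_transGen.1 hba with h' | h'
      · exact h'
      · have h1 := numComponents_lt_of_transGen h
        have h2 := numComponents_lt_of_transGen h'
        omega
  lt_iff_le_not_ge a b := by
    constructor
    · intro h
      refine ⟨h.to_reflTransGen, fun hba => ?_⟩
      have h1 := numComponents_lt_of_transGen h
      rcases Relation.reflTransGen_iff_eq_or_transGen.1 hba with h' | h'
      · subst h'; omega
      · have h2 := numComponents_lt_of_transGen h'
        omega
    · rintro ⟨hab, hba⟩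
      rcases Relation.reflTransGen_iff_eq_or_transGen.1 hab with h | h
      · subst h; exact absurd Relation.ReflTransGen.refl hba
      · exact h

/-- The disjoint union of two trace maps. -/
def disjUnion (b : TraceMap p V) (b' : TraceMap p W) : TraceMap p (V ⊕ W) where
  edge := (Equiv.sumProdDistrib V W (Fin p)).symm.permCongr (Equiv.sumCongr b.edge b'.edge)
  edge_edge h := by
    rcases h with ⟨v | w, i⟩ <;> simp [Equiv.permCongr_apply, b.edge_edge, b'.edge_edge]
  edge_ne h := by
    rcases h with ⟨v | w, i⟩
    · have := b.edge_ne (v, i)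
      simpa [Equiv.permCongr_apply, Prod.ext_iff] using this
    · have := b'.edge_ne (w, i)
      simpa [Equiv.permCongr_apply, Prod.ext_iff] using this

/-- `σ` (on vertices) and `e` (on half-edges) form an isomorphism of combinatorial maps. -/
structure IsIso (b : TraceMap p V) (b' : TraceMap p W) (σ : V ≃ W)
    (e : V × Fin p ≃ W × Fin p) : Prop where
  vertex : ∀ h, (e h).1 = σ h.1
  rot : ∀ h, e (rot p V h) = TensorFree.rot p W (e h)
  edge : ∀ h, e (b.edge h) = b'.edge (e h)

theorem IsIso.refl (b : TraceMap p V) : IsIso b b (Equiv.refl _) (Equiv.refl _) :=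
  ⟨fun _ => rfl, fun _ => rfl, fun _ => rfl⟩

theorem IsIso.symm {b : TraceMap p V} {b' : TraceMap p W} {σ : V ≃ W}
    {e : V × Fin p ≃ W × Fin p} (h : IsIso b b' σ e) : IsIso b' b σ.symm e.symm where
  vertex x := by
    obtain ⟨y, rfl⟩ := e.surjective x
    simp [h.vertex]
  rot x := by
    obtain ⟨y, rfl⟩ := e.surjective x
    rw [← h.rot]; simp
  edge x := by
    obtain ⟨y, rfl⟩ := e.surjective x
    rw [← h.edge]; simp

theorem IsIso.trans {U : Type} {b : TraceMap p V} {b' : TraceMap p W} {b'' : TraceMap p U}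
    {σ : V ≃ W} {e : V × Fin p ≃ W × Fin p} {τ : W ≃ U} {f : W × Fin p ≃ U × Fin p}
    (h : IsIso b b' σ e) (h' : IsIso b' b'' τ f) :
    IsIso b b'' (σ.trans τ) (e.trans f) where
  vertex x := by simp [h'.vertex, h.vertex]
  rot x := by simp [h.rot, h'.rot]
  edge x := by simp [h.edge, h'.edge]

end TraceMap

section FreeCumulant

variable {p : ℕ} {V : Type} [Finite V]

/-- The free cumulants `κ` of a function `f` on the trace maps: the Möbius inversion of `f`
along the non-crossing order, i.e. the unique solution of `f b = ∑_{b' ≤ b} κ b'`; see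
`sum_freeCumulant` and `eq_freeCumulant`. -/
def freeCumulant (f : TraceMap p V → ℝ) : TraceMap p V → ℝ :=
  (wellFounded_lt (α := TraceMap p V)).fix fun b κ =>
    f b - ∑ᶠ b' : {b' : TraceMap p V // b' < b}, κ b'.1 b'.2

theorem freeCumulant_eq (f : TraceMap p V → ℝ) (b : TraceMap p V) :
    freeCumulant f b = f b - ∑ᶠ b' : {b' : TraceMap p V // b' < b}, freeCumulant f b'.1 := by
  unfold freeCumulant
  rw [WellFounded.fix_eq]

theorem finsum_le_eq (κ : TraceMap p V → ℝ) (b : TraceMap p V) :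
    ∑ᶠ b' : {b' : TraceMap p V // b' ≤ b}, κ b'.1 =
      κ b + ∑ᶠ b' : {b' : TraceMap p V // b' < b}, κ b'.1 := by
  have h1 : ∑ᶠ b' : {b' : TraceMap p V // b' ≤ b}, κ b'.1 = ∑ᶠ b' ∈ Set.Iic b, κ b' :=
    finsum_subtype_eq_finsum_cond (fun b' => b' ≤ b)
  have h2 : ∑ᶠ b' : {b' : TraceMap p V // b' < b}, κ b'.1 = ∑ᶠ b' ∈ Set.Iio b, κ b' :=
    finsum_subtype_eq_finsum_cond (fun b' => b' < b)
  rw [h1, h2, ← Set.Iio_insert, finsum_mem_insert _ (by simp) (Set.toFinite _)]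

theorem sum_freeCumulant (f : TraceMap p V → ℝ) (b : TraceMap p V) :
    ∑ᶠ b' : {b' : TraceMap p V // b' ≤ b}, freeCumulant f b'.1 = f b := by
  rw [finsum_le_eq, freeCumulant_eq f b]
  ring

theorem eq_freeCumulant (f κ : TraceMap p V → ℝ)
    (h : ∀ b, ∑ᶠ b' : {b' : TraceMap p V // b' ≤ b}, κ b'.1 = f b) : κ = freeCumulant f := by
  funext b
  induction b using (wellFounded_lt (α := TraceMap p V)).induction with
  | _ b ih =>
    have h1 := h b
    rw [finsum_le_eq] at h1
    rw [freeCumulant_eq, ← h1, ← finsum_congr fun b' : {b' // b' < b} => ih b'.1 b'.2]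
    ring

end FreeCumulant

/-- The joint distribution of a family, indexed by `ι`, of abstract tensors of order `p`: the
value of every trace invariant whose vertices are decorated with members of the family. It
depends only on the isomorphism class of the decorated map, is multiplicative over disjoint
unions, and takes the value 1 on the empty map. -/
structure Distribution (p : ℕ) (ι : Type) where
  val : ∀ {V : Type} [Finite V], TraceMap p V → (V → ι) → ℝ
  val_iso : ∀ {V W : Type} [Finite V] [Finite W] (b : TraceMap p V) (b' : TraceMap p W)
    (σ : V ≃ W) (e : V × Fin p ≃ W × Fin p) (c : W → ι), b.IsIso b' σ e →
    val b (c ∘ σ) = val b' c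
  val_disjUnion : ∀ {V W : Type} [Finite V] [Finite W] (b : TraceMap p V) (b' : TraceMap p W)
    (c : V → ι) (c' : W → ι), val (b.disjUnion b') (Sum.elim c c') = val b c * val b' c'
  val_empty : ∀ {V : Type} [Finite V] [IsEmpty V] (b : TraceMap p V) (c : V → ι), val b c = 1

/-- Connected `p`-regular trace maps with `n` labelled vertices and a root half-edge. -/
structure RootedMap (p n : ℕ) where
  map : TraceMap p (Fin n)
  connected : map.IsConnected
  root : Fin n × Fin p

/-- Two rooted maps are identified when an isomorphism of maps carries root to root. -/
instance rootedSetoid (p n : ℕ) : Setoid (RootedMap p n) where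
  r x y := ∃ σ e, x.map.IsIso y.map σ e ∧ e x.root = y.root
  iseqv :=
    { refl := fun x => ⟨_, _, TraceMap.IsIso.refl x.map, rfl⟩
      symm := by
        rintro x y ⟨σ, e, h, hr⟩
        exact ⟨_, _, h.symm, by rw [← hr]; simp⟩
      trans := by
        rintro x y z ⟨σ, e, h, hr⟩ ⟨τ, f, h', hr'⟩
        exact ⟨_, _, h.trans h', by simp [hr, hr']⟩ }

/-- Connected rooted `p`-regular trace maps with `n` unlabelled vertices. -/
def RootedClass (p n : ℕ) : Type := Quotient (rootedSetoid p n)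

instance (p n : ℕ) : Finite (RootedMap p n) :=
  Finite.of_injective (fun x : RootedMap p n => (x.map, x.root)) fun x y h => by
    cases x; cases y; simp at h; simp [h]

instance (p n : ℕ) : Finite (RootedClass p n) :=
  inferInstanceAs (Finite (Quotient (rootedSetoid p n)))

namespace Distribution

variable {p : ℕ} {ι : Type}

/-- The value of a one-tensor distribution on a rooted map with unlabelled vertices. -/
def rootedVal (a : Distribution p Unit) (n : ℕ) : RootedClass p n → ℝ :=
  Quotient.lift (fun x : RootedMap p n => a.val x.map fun _ => ()) (by
    rintro x y ⟨σ, e, h, -⟩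
    exact a.val_iso x.map y.map σ e (fun _ => ()) h)

/-- The `n`-th moment of a one-tensor distribution: the sum of its values over all connected
rooted `p`-regular trace maps with `n` unlabelled vertices; the 0-th moment is 1. -/
def moment (a : Distribution p Unit) (n : ℕ) : ℝ :=
  if n = 0 then 1 else ∑ᶠ x : RootedClass p n, a.rootedVal n x

/-- The distribution of the `i`-th member of a family. -/
def marginal (φ : Distribution p ι) (i : ι) : Distribution p Unit where
  val b _ := φ.val b fun _ => i
  val_iso b b' σ e _ h := φ.val_iso b b' σ e (fun _ => i) h
  val_disjUnion b b' _ _ := by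
    rw [← φ.val_disjUnion]
    congr 1
    funext x
    cases x <;> rfl
  val_empty b _ := φ.val_empty b _

/-- The distribution of the sum of all members of a finite family: trace invariants are
multilinear, so that the value on `b` is the sum over all decorations of the vertices of `b`. -/
def sum [Finite ι] (φ : Distribution p ι) : Distribution p Unit where
  val {V} _ b _ := ∑ᶠ c : V → ι, φ.val b c
  val_iso {V W} _ _ b b' σ e _ h := by
    refine finsum_eq_of_bijective (fun c : V → ι => c ∘ σ.symm)
      (σ.arrowCongr (Equiv.refl ι)).bijective fun c => ?_
    rw [← φ.val_iso b b' σ e (c ∘ σ.symm) h]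
    congr 1
    funext v
    simp
  val_disjUnion {V W} _ _ b b' _ _ := by
    have : Fintype ι := Fintype.ofFinite ι
    classical
    have : Fintype V := Fintype.ofFinite V
    have : Fintype W := Fintype.ofFinite W
    rw [finsum_eq_sum_of_fintype, finsum_eq_sum_of_fintype, finsum_eq_sum_of_fintype,
      Finset.sum_mul_sum, ← Fintype.sum_prod_type',
      ← (Equiv.sumArrowEquivProdArrow V W ι).symm.sum_comp]
    refine Finset.sum_congr rfl fun c _ => ?_
    exact φ.val_disjUnion b b' c.1 c.2
  val_empty {V} _ _ b _ := by
    have : Fintype V := Fintype.ofFinite V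
    have : Fintype ι := Fintype.ofFinite ι
    classical
    rw [finsum_eq_sum_of_fintype, Fintype.sum_unique]
    exact φ.val_empty b _

/-- Freeness: all mixed free cumulants vanish, i.e. the free cumulant of every connected map that
is decorated with at least two different members of the family is zero. -/
def IsFree (φ : Distribution p ι) : Prop :=
  ∀ (V : Type) [Finite V] (b : TraceMap p V) (c : V → ι), b.IsConnected →
    (∃ v w, c v ≠ c w) → freeCumulant (fun b' => φ.val b' c) b = 0

/-- `μ` is the law of the one-tensor distribution `a`: all moments of `μ` are finite and equal to
those of `a`. -/
def HasLaw (a : Distribution p Unit) (μ : Measure ℝ) : Prop :=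
  ∀ n : ℕ, Integrable (fun x : ℝ => x ^ n) μ ∧ ∫ x, x ^ n ∂μ = a.moment n

end Distribution

/-- A compactly supported probability measure on the real line. -/
def IsCompactProb (μ : Measure ℝ) : Prop :=
  IsProbabilityMeasure μ ∧ ∃ M : ℝ, μ (Set.Icc (-M) M) = 1

/-- The Fuss-Catalan numbers of order `p`. -/
def fussCatalan (p k : ℕ) : ℝ := ((p * k + 1).choose k : ℝ) / (p * k + 1 : ℝ)

/-- `μ` is the semicircular law of order `p`: the compactly supported probability measure whose
odd moments vanish and whose even moments are the Fuss-Catalan numbers of order `p`. -/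
def IsSemicircularLaw (p : ℕ) (μ : Measure ℝ) : Prop :=
  IsCompactProb μ ∧ ∀ n : ℕ, ∫ x, x ^ n ∂μ = if Even n then fussCatalan p (n / 2) else 0

/-- The joint distribution `φ` is that of two free elements with laws `μ` and `ν`. -/
def IsFreePair (p : ℕ) (μ ν : Measure ℝ) (φ : Distribution p (Fin 2)) : Prop :=
  φ.IsFree ∧ (φ.marginal 0).HasLaw μ ∧ (φ.marginal 1).HasLaw ν

/-- `ρ` is the tensorial free convolution of `μ` and `ν`: it is a compactly supported probability
measure, there are free elements with laws `μ` and `ν`, and the sum of any two such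
elements has law `ρ`. -/
def IsTensorFreeConvolution (p : ℕ) (μ ν ρ : Measure ℝ) : Prop :=
  IsCompactProb ρ ∧ (∃ φ : Distribution p (Fin 2), IsFreePair p μ ν φ) ∧
    ∀ φ : Distribution p (Fin 2), IsFreePair p μ ν φ → φ.sum.HasLaw ρ

end TensorFree

end

/-! The core is a functional equation. Let `M = ∑ m_n x ^ n` be the moment series and let `κ_j` be
the normalized sum of the free cumulants of the connected rooted maps with `j` vertices
(`momentSeries`, `rootedCum`). Then `M = 1 + ∑_{j ≥ 1} κ_j x ^ j M ^ (p j / 2)`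
(`coeff_momentSeries`). Hence moments and the numbers `κ_j` determine each other, freeness makes
`κ_j` additive, and dilation by `t` multiplies `κ_j` by `t ^ j`. If `κ_2 = 1` is the only nonzero
one, the equation reads `M = 1 + x ^ 2 M ^ p`, which is solved by the Fuss-Catalan numbers. Two free
copies have `κ_2 = 2 = √2 ^ 2` and all others zero, which is the dilation by `√2`.

To prove the functional equation, every trace invariant is expanded into free cumulants, so that
moments become weighted counts of pairs `b' ≤ b` with `b` connected. Let `c` be the component of
`b'` at a chosen vertex; if it has `j` vertices, it has `p j / 2` edges. By `restore_edge` these can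
be opened one at a time: if `b` lacks an edge of `c`, the switch that restores it stays above `b'`
and cuts off a connected map, which had been attached at one of its half-edges. Summation over the
cumulants below the cut-off part gives back its trace invariant, so each edge of `c` contributes a
factor `M` (`card_connected_above`, `connWeight_step`, `connWeight_eq_coeff`).

Evenness of `p` enters because a map with even degrees has no bridge: a switch between two
components always joins them, so the order is generated upwards by exactly these switches. Passing
from labelled to unlabelled maps is harmless since connected rooted maps have no nontrivial
automorphisms (`moment_eq_coeff`).

Two existence questions remain. A free pair is obtained by prescribing cumulants that are invariant
and multiplicative (`exists_isFree`). The measure exists because the Fuss-Catalan numbers are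
products of a geometric sequence and moment sequences of beta laws; a symmetrized square root then
gives the required moments. Compactly supported measures are determined by their moments. -/

namespace TensorFree
namespace TraceMap

/-! ### Connected components as invariant sets of vertices -/

section Reachability

variable {p : ℕ} {V : Type}

/-- A set of vertices that is a union of connected components. -/
def IsInvariant (b : TraceMap p V) (A : Set V) : Prop :=
  ∀ h, h.1 ∈ A → (b.edge h).1 ∈ A

theorem IsInvariant.mem_iff {b : TraceMap p V} {A : Set V} (hA : b.IsInvariant A)
    (h : V × Fin p) : (b.edge h).1 ∈ A ↔ h.1 ∈ A :=
  ⟨fun H => by simpa [b.edge_edge] using hA _ H, hA h⟩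

theorem reachable_edge (b : TraceMap p V) (h : V × Fin p) :
    b.graph.Reachable h.1 (b.edge h).1 := by
  by_cases heq : h.1 = (b.edge h).1
  · rw [heq]
  · refine SimpleGraph.Adj.reachable ?_
    rw [graph, SimpleGraph.fromRel_adj]
    exact ⟨heq, Or.inl ⟨h.2, (b.edge h).2, rfl⟩⟩

theorem isInvariant_reachable (b : TraceMap p V) (v : V) :
    b.IsInvariant {w | b.graph.Reachable v w} :=
  fun h hh => SimpleGraph.Reachable.trans hh (b.reachable_edge h)

theorem reachable_edge_edge (b : TraceMap p V) {v : V} {x : V × Fin p} :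
    b.graph.Reachable v (b.edge x).1 ↔ b.graph.Reachable v x.1 :=
  (b.isInvariant_reachable v).mem_iff x

/-- Connectivity is always tested against invariant sets, which replaces the handling of paths in
`graph` by that of single half-edges. -/
theorem IsInvariant.mem_of_reachable {b : TraceMap p V} {A : Set V} (hA : b.IsInvariant A)
    {v w : V} (h : b.graph.Reachable v w) (hv : v ∈ A) : w ∈ A := by
  obtain ⟨q⟩ := h
  induction q with
  | nil => exact hv
  | cons hadj _ ih =>
    apply ih
    rw [graph, SimpleGraph.fromRel_adj] at hadj
    obtain ⟨-, ⟨i, j, hij⟩ | ⟨i, j, hij⟩⟩ := hadj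
    · have := hA (_, i) hv
      rwa [hij] at this
    · rw [← hA.mem_iff (_, i), hij]
      exact hv

theorem isConnected_iff (b : TraceMap p V) (v : V) :
    b.IsConnected ↔ ∀ w, b.graph.Reachable v w := by
  constructor
  · exact fun h w => h.preconnected v w
  · exact fun h => (SimpleGraph.connected_iff _).2
      ⟨fun u w => (h u).symm.trans (h w), ⟨v⟩⟩

end Reachability

/-! ### Switches -/

section Switch

variable {p : ℕ} {V : Type}

open Classical in
/-- The trace map obtained by exchanging the end points `x` and `y`. -/
noncomputable def switch (b : TraceMap p V) (x y : V × Fin p) : TraceMap p V where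
  edge := Equiv.swap x y * b.edge * Equiv.swap x y
  edge_edge h := by simp [b.edge_edge]
  edge_ne h := by
    intro H
    apply b.edge_ne (Equiv.swap x y h)
    apply (Equiv.swap x y).injective
    simpa using H

theorem switch_edge [DecidableEq (V × Fin p)] (b : TraceMap p V) (x y h : V × Fin p) :
    (b.switch x y).edge h = Equiv.swap x y (b.edge (Equiv.swap x y h)) := by
  simp only [switch, Equiv.Perm.coe_mul, Function.comp_apply]
  congr!

theorem switch_comm (b : TraceMap p V) (x y : V × Fin p) : b.switch x y = b.switch y x := by
  classical
  ext1
  simp only [switch, Equiv.swap_comm]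

@[simp]
theorem switch_switch (b : TraceMap p V) (x y : V × Fin p) : (b.switch x y).switch x y = b := by
  classical
  ext h : 2
  simp [switch_edge]

theorem switch_edge_of_ne {b : TraceMap p V} {x y h : V × Fin p} (h1 : h ≠ x) (h2 : h ≠ y)
    (h3 : h ≠ b.edge x) (h4 : h ≠ b.edge y) : (b.switch x y).edge h = b.edge h := by
  classical
  rw [switch_edge, Equiv.swap_apply_of_ne_of_ne h1 h2, Equiv.swap_apply_of_ne_of_ne]
  · rintro rfl; exact h3 (b.edge_edge h).symm
  · rintro rfl; exact h4 (b.edge_edge h).symm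

theorem switch_edge_left {b : TraceMap p V} {x y : V × Fin p} (h : b.edge x ≠ y) :
    (b.switch x y).edge x = b.edge y := by
  classical
  rw [switch_edge, Equiv.swap_apply_left, Equiv.swap_apply_of_ne_of_ne _ (b.edge_ne y)]
  rintro rfl; exact h (b.edge_edge y)

theorem edge_ne_comm {b : TraceMap p V} {x y : V × Fin p} (h : b.edge x ≠ y) : b.edge y ≠ x := by
  rintro rfl; exact h (b.edge_edge y)

theorem switch_edge_right {b : TraceMap p V} {x y : V × Fin p} (h : b.edge x ≠ y) :
    (b.switch x y).edge y = b.edge x := by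
  rw [switch_comm, switch_edge_left (edge_ne_comm h)]

theorem switch_edge_edge_left {b : TraceMap p V} {x y : V × Fin p} (h : b.edge x ≠ y) :
    (b.switch x y).edge (b.edge x) = y := by
  rw [← switch_edge_right h, edge_edge]

theorem switch_edge_edge_right {b : TraceMap p V} {x y : V × Fin p} (h : b.edge x ≠ y) :
    (b.switch x y).edge (b.edge y) = x := by
  rw [← switch_edge_left h, edge_edge]

/-- Exchanging two end points of edges, or their opposite end points, has the same effect. -/
theorem switch_edge_edge (b : TraceMap p V) (x y : V × Fin p) :
    b.switch (b.edge x) (b.edge y) = b.switch x y := by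
  by_cases hxy : b.edge x = y
  · rw [hxy, ← hxy, edge_edge, switch_comm]
  have hyx := edge_ne_comm hxy
  have hxy' : b.edge (b.edge x) ≠ b.edge y := fun h => hyx (by rw [← h, b.edge_edge])
  ext h : 2
  by_cases h1 : h = x
  · subst h1
    rw [switch_edge_left hxy]
    have := switch_edge_edge_left hxy'
    rwa [b.edge_edge] at this
  by_cases h2 : h = y
  · subst h2
    rw [switch_edge_right hxy]
    have := switch_edge_edge_right hxy'
    rwa [b.edge_edge] at this
  by_cases h3 : h = b.edge x
  · subst h3
    rw [switch_edge_edge_left hxy, switch_edge_left hxy', edge_edge]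
  by_cases h4 : h = b.edge y
  · subst h4
    rw [switch_edge_edge_right hxy, switch_edge_right hxy', edge_edge]
  rw [switch_edge_of_ne h1 h2 h3 h4, switch_edge_of_ne h3 h4] <;> rwa [edge_edge]

theorem isSwitch_switch {b : TraceMap p V} {x y : V × Fin p} (hxy : x ≠ y) (h : b.edge x ≠ y) :
    IsSwitch b (b.switch x y) := by
  refine ⟨x, y, hxy, ?_, ?_⟩
  · rw [switch_edge_left h]; exact b.edge_ne y
  · exact congrArg TraceMap.edge (switch_switch b x y).symm

theorem IsSwitch.exists_switch {b' b : TraceMap p V} (h : IsSwitch b' b) :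
    ∃ x y, x ≠ y ∧ b'.edge x ≠ y ∧ b = b'.switch x y := by
  obtain ⟨x, y, hxy, hb, he⟩ := h
  have : b' = b.switch x y := TraceMap.ext he
  refine ⟨x, y, hxy, ?_, by rw [this, switch_switch]⟩
  rw [this, switch_edge_left hb]
  exact b.edge_ne y

theorem IsInvariant.switch {b : TraceMap p V} {A : Set V} (hA : b.IsInvariant A)
    {x y : V × Fin p} (hxy : x.1 ∈ A ↔ y.1 ∈ A) : (b.switch x y).IsInvariant A := by
  classical
  have key : ∀ h : V × Fin p, (Equiv.swap x y h).1 ∈ A ↔ h.1 ∈ A := by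
    intro h
    rcases eq_or_ne h x with rfl | h1
    · rw [Equiv.swap_apply_left, hxy]
    rcases eq_or_ne h y with rfl | h2
    · rw [Equiv.swap_apply_right, hxy]
    rw [Equiv.swap_apply_of_ne_of_ne h1 h2]
  intro h hh
  rw [switch_edge, key, hA.mem_iff, key]
  exact hh

/-- Each component of `b` contains both end points or neither, so it stays invariant: a switch
inside one component can only split it. -/
theorem reachable_of_reachable_switch {b : TraceMap p V} {x y : V × Fin p}
    (hxy : b.graph.Reachable x.1 y.1) {v w : V} (h : (b.switch x y).graph.Reachable v w) :
    b.graph.Reachable v w := by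
  have hA := b.isInvariant_reachable v
  refine (hA.switch ?_).mem_of_reachable h (SimpleGraph.Reachable.refl v)
  exact ⟨fun H => H.trans hxy, fun H => H.trans hxy.symm⟩

theorem numComponents_le_of_reachable [Finite V] {b b' : TraceMap p V}
    (h : ∀ v w, b'.graph.Reachable v w → b.graph.Reachable v w) :
    b.numComponents ≤ b'.numComponents := by
  refine Nat.card_le_card_of_surjective
    (SimpleGraph.ConnectedComponent.lift (fun v => b.graph.connectedComponentMk v)
      fun v w q _ => SimpleGraph.ConnectedComponent.sound (h v w ⟨q⟩)) ?_
  intro c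
  induction c using SimpleGraph.ConnectedComponent.ind with
  | _ v => exact ⟨b'.graph.connectedComponentMk v, rfl⟩

end Switch

/-! ### Even degrees: switches between components and the non-crossing order -/

section Join

variable {p : ℕ} {V : Type}

/-- A map with all degrees even has no bridge. -/
theorem mem_edge_of_even [Finite V] (hp : Even p) {b : TraceMap p V} {A : Set V}
    {x : V × Fin p} (hA : ∀ h, h ≠ x → h.1 ∈ A → (b.edge h).1 ∈ A) (hx : x.1 ∈ A) :
    (b.edge x).1 ∈ A := by
  classical
  have : Fintype V := Fintype.ofFinite V
  by_contra hx'
  let s : Finset (V × Fin p) := Finset.univ.filter fun h => h.1 ∈ A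
  have hxs : x ∈ s := by simp [s, hx]
  have hs : s.card = (Finset.univ.filter fun v => v ∈ A).card * p := by
    have : s = (Finset.univ.filter fun v => v ∈ A) ×ˢ Finset.univ := by
      ext h; simp [s]
    rw [this, Finset.card_product]; simp
  have heven : Even s.card := by rw [hs]; exact hp.mul_left _
  -- The edges pair off all half-edges at `A` other than `x`, whereas the half-edges at `A` are `p *
  -- |A|` in number, which is even.
  have hsum : ∑ h ∈ s.erase x, (1 : ZMod 2) = 0 := by
    refine Finset.sum_involution (fun h _ => b.edge h) ?_ ?_ ?_ ?_
    · intro a ha; decide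
    · intro a ha _; exact b.edge_ne a
    · intro a ha
      simp only [s, Finset.mem_erase, Finset.mem_filter, Finset.mem_univ, true_and] at ha ⊢
      refine ⟨?_, hA a ha.1 ha.2⟩
      rintro rfl
      rw [b.edge_edge] at hx'
      exact hx' ha.2
    · intro a ha; exact b.edge_edge a
  rw [Finset.sum_const, nsmul_one, ZMod.natCast_eq_zero_iff_even, Finset.card_erase_of_mem hxs]
    at hsum
  have : 0 < s.card := Finset.card_pos.2 ⟨x, hxs⟩
  rcases heven with ⟨k, hk⟩
  rcases hsum with ⟨l, hl⟩
  omega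

/-- If `A` did not contain the far end of the edge at `x`, that edge would be a bridge of `b` inside
the component of `x`. -/
theorem IsInvariant.of_switch [Finite V] (hp : Even p) {b : TraceMap p V} {x y : V × Fin p}
    (hxy : ¬ b.graph.Reachable x.1 y.1) {A : Set V} (hA : (b.switch x y).IsInvariant A)
    (hx : x.1 ∈ A) : y.1 ∈ A ∧ b.IsInvariant A := by
  have hne : b.edge x ≠ y := by rintro rfl; exact hxy (b.reachable_edge x)
  have hy' : (b.edge y).1 ∈ A := by
    have := hA x hx
    rwa [switch_edge_left hne] at this
  have hx' : (b.edge x).1 ∈ A := by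
    by_contra hx'
    have hX := b.isInvariant_reachable x.1
    -- Apart from `x` the switch only affects `y` and `b.edge y`, which lie outside the component of
    -- `x`, and `b.edge x`, which lies outside `A`.
    refine hx' (mem_edge_of_even hp (A := A ∩ {w | b.graph.Reachable x.1 w}) ?_
      ⟨hx, SimpleGraph.Reachable.refl _⟩).1
    rintro h hh ⟨h1, h2⟩
    refine ⟨?_, hX h h2⟩
    have := hA h h1
    rwa [switch_edge_of_ne hh] at this
    · rintro rfl; exact hxy h2
    · rintro rfl; exact hx' h1
    · rintro rfl; exact hxy ((hX.mem_iff y).1 h2)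
  have hy : y.1 ∈ A := by
    have := hA _ hx'
    rwa [switch_edge_edge_left hne] at this
  refine ⟨hy, ?_⟩
  have := hA.switch (x := x) (y := y) (by simp [hx, hy])
  rwa [switch_switch] at this

theorem reachable_switch [Finite V] (hp : Even p) {b : TraceMap p V} {x y : V × Fin p}
    (hxy : ¬ b.graph.Reachable x.1 y.1) : (b.switch x y).graph.Reachable x.1 y.1 :=
  (((b.switch x y).isInvariant_reachable x.1).of_switch hp hxy (SimpleGraph.Reachable.refl _)).1

theorem reachable_switch_of_reachable [Finite V] (hp : Even p) {b : TraceMap p V}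
    {x y : V × Fin p} (hxy : ¬ b.graph.Reachable x.1 y.1) {v w : V}
    (h : b.graph.Reachable v w) : (b.switch x y).graph.Reachable v w := by
  rw [← switch_switch b x y] at h
  exact reachable_of_reachable_switch (reachable_switch hp hxy) h

theorem reachable_switch_iff [Finite V] (hp : Even p) {b : TraceMap p V} {x y : V × Fin p}
    (hxy : ¬ b.graph.Reachable x.1 y.1) {v w : V} :
    (b.switch x y).graph.Reachable v w ↔ b.graph.Reachable v w ∨
      (b.graph.Reachable x.1 v ∨ b.graph.Reachable y.1 v) ∧
      (b.graph.Reachable x.1 w ∨ b.graph.Reachable y.1 w) := by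
  constructor
  · intro h
    by_cases hv : b.graph.Reachable x.1 v ∨ b.graph.Reachable y.1 v
    · refine Or.inr ⟨hv, ?_⟩
      have hA : b.IsInvariant {w | b.graph.Reachable x.1 w ∨ b.graph.Reachable y.1 w} :=
        fun h hh => hh.imp (b.isInvariant_reachable _ h) (b.isInvariant_reachable _ h)
      exact (hA.switch (x := x) (y := y)
        ⟨fun _ => Or.inr (SimpleGraph.Reachable.refl _),
          fun _ => Or.inl (SimpleGraph.Reachable.refl _)⟩).mem_of_reachable h hv
    · left
      refine ((b.isInvariant_reachable v).switch (x := x) (y := y) ?_).mem_of_reachable h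
        (SimpleGraph.Reachable.refl v)
      exact ⟨fun H => absurd (Or.inl H.symm) hv, fun H => absurd (Or.inr H.symm) hv⟩
  · have h1 := reachable_switch hp hxy
    have key : ∀ v, b.graph.Reachable x.1 v ∨ b.graph.Reachable y.1 v →
        (b.switch x y).graph.Reachable x.1 v := fun v hv =>
      hv.elim (reachable_switch_of_reachable hp hxy)
        fun H => h1.trans (reachable_switch_of_reachable hp hxy H)
    rintro (h | ⟨h2, h3⟩)
    · exact reachable_switch_of_reachable hp hxy h
    · exact (key v h2).symm.trans (key w h3)

/-- The component of `y` is absorbed by that of `x` and the others are unchanged, so the components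
of `b` other than that of `y` correspond to those of the switched map. -/
theorem numComponents_switch [Finite V] (hp : Even p) {b : TraceMap p V} {x y : V × Fin p}
    (hxy : ¬ b.graph.Reachable x.1 y.1) :
    b.numComponents = (b.switch x y).numComponents + 1 := by
  classical
  let Y := b.graph.connectedComponentMk y.1
  let f : {c : b.graph.ConnectedComponent // c ≠ Y} →
      (b.switch x y).graph.ConnectedComponent := fun c =>
    SimpleGraph.ConnectedComponent.lift (fun v => (b.switch x y).graph.connectedComponentMk v)
      (fun v w q _ => SimpleGraph.ConnectedComponent.sound
        (reachable_switch_of_reachable hp hxy ⟨q⟩)) c.1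
  have hf : Function.Bijective f := by
    constructor
    · rintro ⟨c, hc⟩ ⟨d, hd⟩ h
      induction c using SimpleGraph.ConnectedComponent.ind with
      | _ v =>
      induction d using SimpleGraph.ConnectedComponent.ind with
      | _ w =>
      have hc' : ¬ b.graph.Reachable y.1 v :=
        fun H => hc (SimpleGraph.ConnectedComponent.sound H.symm)
      have hd' : ¬ b.graph.Reachable y.1 w :=
        fun H => hd (SimpleGraph.ConnectedComponent.sound H.symm)
      have h' := (reachable_switch_iff hp hxy).1 (SimpleGraph.ConnectedComponent.exact h)
      refine Subtype.ext (SimpleGraph.ConnectedComponent.sound ?_)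
      rcases h' with h' | ⟨h1, h2⟩
      · exact h'
      · exact (h1.resolve_right hc').symm.trans (h2.resolve_right hd')
    · intro c
      induction c using SimpleGraph.ConnectedComponent.ind with
      | _ v =>
      by_cases hv : b.graph.Reachable y.1 v
      · refine ⟨⟨b.graph.connectedComponentMk x.1,
          fun H => hxy (SimpleGraph.ConnectedComponent.exact H)⟩, ?_⟩
        refine SimpleGraph.ConnectedComponent.sound ((reachable_switch hp hxy).trans ?_)
        exact reachable_switch_of_reachable hp hxy hv
      · exact ⟨⟨b.graph.connectedComponentMk v,
          fun H => hv (SimpleGraph.ConnectedComponent.exact H).symm⟩, rfl⟩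
  have h1 := Nat.card_congr (Equiv.ofBijective f hf)
  have : Fintype b.graph.ConnectedComponent := Fintype.ofFinite _
  have h2 : 0 < Fintype.card b.graph.ConnectedComponent := Fintype.card_pos_iff.2 ⟨Y⟩
  rw [Nat.card_eq_fintype_card, Fintype.card_subtype_compl, Fintype.card_subtype_eq] at h1
  rw [numComponents, numComponents, ← h1, Nat.card_eq_fintype_card]
  omega

theorem stepDown_switch [Finite V] (hp : Even p) {b : TraceMap p V} {x y : V × Fin p}
    (hxy : ¬ b.graph.Reachable x.1 y.1) : StepDown b (b.switch x y) := by
  refine ⟨isSwitch_switch ?_ ?_, numComponents_switch hp hxy⟩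
  · rintro rfl; exact hxy (SimpleGraph.Reachable.refl _)
  · rintro rfl; exact hxy (b.reachable_edge x)

/-- A switch inside a component refines the partition into components, so it cannot lower their
number. -/
theorem StepDown.not_reachable [Finite V] {b : TraceMap p V} {x y : V × Fin p}
    (h : StepDown b (b.switch x y)) : ¬ b.graph.Reachable x.1 y.1 := by
  intro H
  have h1 := numComponents_le_of_reachable (b := b) (b' := b.switch x y)
    fun v w => reachable_of_reachable_switch H
  have := h.2
  omega

/-- Every induction along the order uses this form: going up one step joins two components. -/
theorem StepDown.exists_switch [Finite V] {b' b : TraceMap p V}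
    (h : StepDown b' b) : ∃ x y, ¬ b'.graph.Reachable x.1 y.1 ∧ b = b'.switch x y := by
  obtain ⟨x, y, -, -, rfl⟩ := h.1.exists_switch
  exact ⟨x, y, h.not_reachable, rfl⟩

theorem reachable_of_le [Finite V] (hp : Even p) {b' b : TraceMap p V} (h : b' ≤ b) {v w : V}
    (hvw : b'.graph.Reachable v w) : b.graph.Reachable v w := by
  induction h with
  | refl => exact hvw
  | tail _ hs ih =>
    obtain ⟨x, y, hxy, rfl⟩ := hs.exists_switch
    exact reachable_switch_of_reachable hp hxy ih

theorem StepDown.le {b' b : TraceMap p V} (h : StepDown b' b) : b' ≤ b :=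
  Relation.ReflTransGen.single h

/-- Two consecutive switches that share a half-edge. -/
theorem switch_switch_of_ne {b : TraceMap p V} {x y z : V × Fin p} (hxy : x ≠ y) (hxz : x ≠ z)
    (hyz : y ≠ z) :
    (b.switch y z).switch x z = (b.switch x y).switch y z := by
  classical
  have key : Equiv.swap x z * Equiv.swap y z = Equiv.swap y z * Equiv.swap x y := by
    ext1 h
    simp only [Equiv.Perm.coe_mul, Function.comp_apply, Equiv.swap_apply_def]
    split_ifs <;> simp_all
  have key' : Equiv.swap y z * Equiv.swap x z = Equiv.swap x y * Equiv.swap y z := by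
    have := congrArg (·⁻¹) key
    simpa [mul_inv_rev] using this
  ext1
  simp only [switch]
  calc _ = (Equiv.swap x z * Equiv.swap y z) * b.edge * (Equiv.swap y z * Equiv.swap x z) := by
        simp only [mul_assoc]
    _ = _ := by rw [key, key']; simp only [mul_assoc]

theorem switch_switch_of_disjoint {b : TraceMap p V} {x y z w : V × Fin p} (hxz : x ≠ z)
    (hxw : x ≠ w) (hyz : y ≠ z) (hyw : y ≠ w) :
    (b.switch z w).switch x y = (b.switch x y).switch z w := by
  classical
  have key : Equiv.swap x y * Equiv.swap z w = Equiv.swap z w * Equiv.swap x y := by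
    ext1 h
    simp only [Equiv.Perm.coe_mul, Function.comp_apply, Equiv.swap_apply_def]
    split_ifs <;> simp_all
  ext1
  simp only [switch]
  calc _ = (Equiv.swap x y * Equiv.swap z w) * b.edge * (Equiv.swap z w * Equiv.swap x y) := by
        simp only [mul_assoc]
    _ = (Equiv.swap z w * Equiv.swap x y) * b.edge * (Equiv.swap x y * Equiv.swap z w) := by
        rw [key]
    _ = _ := by simp only [mul_assoc]

/-- If `b' ≤ b` and the edge of `b'` at `x` is not an edge of `b`, then the switch of `b` that
restores this edge is a step down and still lies above `b'`. -/
theorem restore_edge [Finite V] (hp : Even p) {b' b : TraceMap p V} (h : b' ≤ b)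
    {x : V × Fin p} (hx : b.edge x ≠ b'.edge x) :
    b' ≤ b.switch (b'.edge x) (b.edge x) ∧ StepDown (b.switch (b'.edge x) (b.edge x)) b := by
  induction h with
  | refl => exact absurd rfl hx
  | @tail c b hc hs ih =>
    have hc' : b' ≤ c := hc
    obtain ⟨u, w, huw, rfl⟩ := hs.exists_switch
    set x' := b'.edge x with hx'
    set s := c.switch u w with hsdef
    have hne : ∀ {u w : V × Fin p}, ¬ c.graph.Reachable u.1 w.1 → c.edge u ≠ w := by
      rintro u w huw rfl; exact huw (c.reachable_edge u)
    have hne' : ∀ {u w : V × Fin p}, ¬ c.graph.Reachable u.1 w.1 → u ≠ w := by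
      rintro u w huw rfl; exact huw (SimpleGraph.Reachable.refl _)
    -- If `c` still has the edge, the last switch destroyed it and restoring it undoes that switch.
    -- Otherwise the edge can be restored already in `c`, giving `d`, and the last switch is carried
    -- over to `d`, with other half-edges if the two switches overlap.
    by_cases hcx : c.edge x = x'
    · suffices H : s.switch x' (s.edge x) = c by rw [H]; exact ⟨hc, hs⟩
      have key : ∀ u w : V × Fin p, ¬ c.graph.Reachable u.1 w.1 → s = c.switch u w →
          x = u ∨ x = c.edge u → s.switch x' (s.edge x) = c := by
        rintro u w huw hs (rfl | rfl)
        · rw [hs, switch_edge_left (hne huw), ← hcx, ← switch_edge_edge c x w, switch_switch]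
        · rw [c.edge_edge] at hcx
          rw [hs, switch_edge_edge_left (hne huw), ← hcx, switch_switch]
      by_cases h1 : x = u ∨ x = c.edge u
      · exact key u w huw hsdef h1
      by_cases h2 : x = w ∨ x = c.edge w
      · exact key w u (fun H => huw H.symm) (by rw [hsdef, switch_comm]) h2
      push Not at h1 h2
      exact absurd (by rw [hsdef, switch_edge_of_ne h1.1 h2.1 h1.2 h2.2, hcx]) hx
    · obtain ⟨ih1, ih2⟩ := ih hcx
      set y := c.edge x with hy
      set d := c.switch x' y with hd
      have hmono : ∀ {v w}, d.graph.Reachable v w → c.graph.Reachable v w :=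
        fun H => reachable_of_le hp ih2.le H
      have hxy : c.graph.Reachable x.1 y.1 := c.reachable_edge x
      have hxx' : c.graph.Reachable x.1 x'.1 := reachable_of_le hp hc' (b'.reachable_edge x)
      have hcnum := ih2.2
      have hsnum := hs.2
      -- it suffices to write the map as a switch of `d` between different components
      have finish : ∀ u w : V × Fin p, ¬ c.graph.Reachable u.1 w.1 →
          s.switch x' (s.edge x) = d.switch u w → x' ≠ s.edge x → s.edge x' ≠ s.edge x →
          b' ≤ s.switch x' (s.edge x) ∧ StepDown (s.switch x' (s.edge x)) s := by
        intro u w huw he h1 h2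
        have hst := stepDown_switch hp (b := d) (fun H => huw (hmono H))
        rw [he]
        refine ⟨le_trans ih1 hst.le, ?_, ?_⟩
        · rw [← he]
          have := isSwitch_switch (b := s.switch x' (s.edge x)) h1 ?_
          · rwa [switch_switch] at this
          · rw [switch_edge_left h2, s.edge_edge]
            exact fun H => s.edge_ne x H.symm
        -- The map `d` has one component more than `c` and `s` one less, so joining two components
        -- of `d` gives one component more than `s` has.
        · have := hst.2
          omega
      have hsx : x' ≠ s.edge x := fun H => hx H.symm
      have hsx' : s.edge x' ≠ s.edge x := fun H => b'.edge_ne x (s.edge.injective H)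
      -- the two overlapping configurations
      have case1 : ∀ w : V × Fin p, ¬ c.graph.Reachable y.1 w.1 → s = c.switch y w →
          b' ≤ s.switch x' (s.edge x) ∧ StepDown (s.switch x' (s.edge x)) s := by
        intro w hyw hsw
        refine finish y w hyw ?_ hsx hsx'
        have : s.edge x = w := by
          rw [hsw]
          have := switch_edge_edge_left (hne hyw)
          rwa [hy, c.edge_edge] at this
        rw [this, hsw, hd, switch_switch_of_ne (fun H => hcx H.symm) _ (hne' hyw)]
        exact hne' fun H => hyw ((hxy.symm.trans hxx').trans H)
      have case2 : ∀ w : V × Fin p, ¬ c.graph.Reachable x'.1 w.1 → s = c.switch x' w →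
          b' ≤ s.switch x' (s.edge x) ∧ StepDown (s.switch x' (s.edge x)) s := by
        intro w hxw hsw
        have hyw : ¬ c.graph.Reachable y.1 w.1 := fun H => hxw ((hxx'.symm.trans hxy).trans H)
        refine finish y w hyw ?_ hsx hsx'
        have : s.edge x = y := by
          rw [hsw, switch_edge_of_ne]
          · exact fun H => b'.edge_ne x (hx' ▸ H).symm
          · exact hne' fun H => hxw (hxx'.symm.trans H)
          · intro H
            apply hcx
            rw [hy, H, c.edge_edge]
          · intro H
            exact hxw (hxx'.symm.trans (by rw [H]; exact (c.reachable_edge w).symm))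
        rw [this, hsw, hd]
        have hxy' : x' ≠ y := fun H => hcx H.symm
        rw [switch_comm c x' w, switch_comm _ x' y, switch_switch_of_ne (hne' hyw) hxy'.symm
          (hne' hxw).symm, switch_comm _ w x', switch_switch_of_ne hxy' (hne' hxw) (hne' hyw)]
      have overlap : ∀ u w : V × Fin p, ¬ c.graph.Reachable u.1 w.1 → s = c.switch u w →
          (u = x ∨ u = y) ∨ (u = x' ∨ u = c.edge x') →
          b' ≤ s.switch x' (s.edge x) ∧ StepDown (s.switch x' (s.edge x)) s := by
        have hcw : ∀ u w : V × Fin p, ¬ c.graph.Reachable u.1 w.1 →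
            ¬ c.graph.Reachable (c.edge u).1 (c.edge w).1 := fun u w huw H =>
          huw (((c.reachable_edge u).trans H).trans (c.reachable_edge w).symm)
        rintro u w huw hsw ((rfl | rfl) | (rfl | rfl))
        · exact case1 (c.edge w) (hcw _ _ huw) (by rw [hsw, ← switch_edge_edge])
        · exact case1 w huw hsw
        · exact case2 w huw hsw
        · refine case2 (c.edge w) ?_ ?_
          · have := hcw _ _ huw
            rwa [c.edge_edge] at this
          · rw [hsw, ← switch_edge_edge, c.edge_edge]
      by_cases h1 : (u = x ∨ u = y) ∨ (u = x' ∨ u = c.edge x')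
      · exact overlap u w huw hsdef h1
      by_cases h2 : (w = x ∨ w = y) ∨ (w = x' ∨ w = c.edge x')
      · exact overlap w u (fun H => huw H.symm) (by rw [hsdef, switch_comm]) h2
      push Not at h1 h2
      refine finish u w huw ?_ hsx hsx'
      have : s.edge x = y := by
        rw [hsdef, switch_edge_of_ne h1.1.1.symm h2.1.1.symm]
        · intro H; apply h1.1.2; rw [hy, H, c.edge_edge]
        · intro H; apply h2.1.2; rw [hy, H, c.edge_edge]
      rw [this, hsdef, hd, switch_switch_of_disjoint h1.2.1.symm h2.2.1.symm h1.1.2.symm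
        h2.1.2.symm]

end Join

end TraceMap
end TensorFree

namespace TensorFree
namespace TraceMap

noncomputable instance {p : ℕ} {V : Type} [Finite V] : Fintype (TraceMap p V) := Fintype.ofFinite _

/-! ### Transport along bijections of half-edges -/

section Map

variable {p : ℕ} {V W : Type}

/-- Transport of a trace map along a bijection of half-edges. -/
def map (e : V × Fin p ≃ W × Fin p) (b : TraceMap p V) : TraceMap p W where
  edge := e.permCongr b.edge
  edge_edge h := by simp [Equiv.permCongr_apply, b.edge_edge]
  edge_ne h H := by
    apply b.edge_ne (e.symm h)
    rw [Equiv.permCongr_apply] at H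
    rw [← e.injective.eq_iff, H]; simp

theorem map_edge (e : V × Fin p ≃ W × Fin p) (b : TraceMap p V) (h : V × Fin p) :
    (b.map e).edge (e h) = e (b.edge h) := by
  simp [map, Equiv.permCongr_apply]

theorem map_symm_map (e : V × Fin p ≃ W × Fin p) (b : TraceMap p V) :
    (b.map e).map e.symm = b := by
  ext h : 2; simp [map, Equiv.permCongr_apply]

theorem map_map_symm (e : V × Fin p ≃ W × Fin p) (b : TraceMap p W) :
    (b.map e.symm).map e = b := by
  ext h : 2; simp [map, Equiv.permCongr_apply]

/-- Transport of trace maps along a bijection of half-edges, as an equivalence. -/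
@[simps]
def mapEquiv (e : V × Fin p ≃ W × Fin p) : TraceMap p V ≃ TraceMap p W where
  toFun := map e
  invFun := map e.symm
  left_inv := map_symm_map e
  right_inv := map_map_symm e

theorem IsIso.eq_map {b : TraceMap p V} {b' : TraceMap p W} {σ : V ≃ W}
    {e : V × Fin p ≃ W × Fin p} (h : b.IsIso b' σ e) : b' = b.map e := by
  ext x : 2
  obtain ⟨y, rfl⟩ := e.surjective x
  rw [map_edge, h.edge]

theorem isIso_map {σ : V ≃ W} {e : V × Fin p ≃ W × Fin p} (b : TraceMap p V)
    (hv : ∀ h, (e h).1 = σ h.1) (hr : ∀ h, e (TensorFree.rot p V h) = TensorFree.rot p W (e h)) :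
    b.IsIso (b.map e) σ e := ⟨hv, hr, fun h => (map_edge e b h).symm⟩

theorem map_switch (e : V × Fin p ≃ W × Fin p) (b : TraceMap p V) (x y : V × Fin p) :
    (b.switch x y).map e = (b.map e).switch (e x) (e y) := by
  classical
  have key : ∀ h, e (Equiv.swap x y h) = Equiv.swap (e x) (e y) (e h) := by
    exact fun h => e.injective.map_swap x y h
  ext h : 2
  obtain ⟨h, rfl⟩ := e.surjective h
  rw [map_edge, switch_edge, switch_edge, key, ← map_edge, key]

theorem IsInvariant.map {σ : V ≃ W} {e : V × Fin p ≃ W × Fin p} (hv : ∀ h, (e h).1 = σ h.1)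
    {b : TraceMap p V} {A : Set V} (hA : b.IsInvariant A) :
    (b.map e).IsInvariant (σ '' A) := by
  intro h hh
  obtain ⟨h, rfl⟩ := e.surjective h
  rw [hv, σ.injective.mem_set_image] at hh
  rw [map_edge, hv, σ.injective.mem_set_image]
  exact hA h hh

theorem vertex_symm {σ : V ≃ W} {e : V × Fin p ≃ W × Fin p} (hv : ∀ h, (e h).1 = σ h.1)
    (h : W × Fin p) : (e.symm h).1 = σ.symm h.1 := by
  obtain ⟨h, rfl⟩ := e.surjective h
  simp [hv]

theorem reachable_map {σ : V ≃ W} {e : V × Fin p ≃ W × Fin p} (hv : ∀ h, (e h).1 = σ h.1)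
    {b : TraceMap p V} {v w : V} (h : b.graph.Reachable v w) :
    (b.map e).graph.Reachable (σ v) (σ w) := by
  have := ((b.map e).isInvariant_reachable (σ v)).map (vertex_symm hv)
  rw [map_symm_map] at this
  obtain ⟨u, hu, rfl⟩ := this.mem_of_reachable h ⟨σ v, SimpleGraph.Reachable.refl _, by simp⟩
  simpa using hu

theorem reachable_map_iff {σ : V ≃ W} {e : V × Fin p ≃ W × Fin p} (hv : ∀ h, (e h).1 = σ h.1)
    {b : TraceMap p V} {v w : V} :
    (b.map e).graph.Reachable (σ v) (σ w) ↔ b.graph.Reachable v w := by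
  refine ⟨fun h => ?_, reachable_map hv⟩
  have := reachable_map (vertex_symm hv) h
  simpa [map_symm_map] using this

theorem isConnected_map_iff {σ : V ≃ W} {e : V × Fin p ≃ W × Fin p} (hv : ∀ h, (e h).1 = σ h.1)
    {b : TraceMap p V} : (b.map e).IsConnected ↔ b.IsConnected := by
  rcases isEmpty_or_nonempty V with hV | ⟨⟨v⟩⟩
  · have hW := σ.symm.isEmpty
    exact ⟨fun h => (hW.false h.nonempty.some).elim, fun h => (hV.false h.nonempty.some).elim⟩
  · rw [isConnected_iff _ (σ v), isConnected_iff _ v, ← σ.forall_congr_right]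
    simp only [reachable_map_iff hv]

theorem map_le_map [Finite V] [Finite W] (hp : Even p) {σ : V ≃ W} {e : V × Fin p ≃ W × Fin p}
    (hv : ∀ h, (e h).1 = σ h.1) {b' b : TraceMap p V} (h : b' ≤ b) : b'.map e ≤ b.map e := by
  induction h with
  | refl => exact le_rfl
  | tail _ hs ih =>
    obtain ⟨x, y, hxy, rfl⟩ := hs.exists_switch
    refine le_trans ih (StepDown.le ?_)
    rw [map_switch]
    apply stepDown_switch hp
    rwa [hv, hv, reachable_map_iff hv]

theorem map_le_map_iff [Finite V] [Finite W] (hp : Even p) {σ : V ≃ W}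
    {e : V × Fin p ≃ W × Fin p} (hv : ∀ h, (e h).1 = σ h.1) {b' b : TraceMap p V} :
    b'.map e ≤ b.map e ↔ b' ≤ b := by
  refine ⟨fun h => ?_, map_le_map hp hv⟩
  have := map_le_map hp (vertex_symm hv) h
  rwa [map_symm_map, map_symm_map] at this

/-- The bijection of half-edges induced by a bijection of vertices. -/
def halfEdgeEquiv (p : ℕ) (σ : V ≃ W) : V × Fin p ≃ W × Fin p := σ.prodCongr (Equiv.refl _)

theorem halfEdgeEquiv_fst (σ : V ≃ W) (h : V × Fin p) : (halfEdgeEquiv p σ h).1 = σ h.1 := rfl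

/-- Relabelling of the vertices of a trace map. -/
def relabel (σ : V ≃ W) (b : TraceMap p V) : TraceMap p W := b.map (halfEdgeEquiv p σ)

theorem isIso_relabel (σ : V ≃ W) (b : TraceMap p V) :
    b.IsIso (b.relabel σ) σ (halfEdgeEquiv p σ) :=
  isIso_map b (halfEdgeEquiv_fst σ) fun _ => rfl

end Map

/-! ### Disjoint unions and the order ideals below them -/

section DisjUnion

variable {p : ℕ} {V W : Type}

/-- Inclusion of the half-edges of the first summand. -/
def inlHalf (h : V × Fin p) : (V ⊕ W) × Fin p := (Sum.inl h.1, h.2)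

/-- Inclusion of the half-edges of the second summand. -/
def inrHalf (h : W × Fin p) : (V ⊕ W) × Fin p := (Sum.inr h.1, h.2)

theorem inlHalf_injective : Function.Injective (inlHalf : V × Fin p → (V ⊕ W) × Fin p) := by
  rintro ⟨v, i⟩ ⟨w, j⟩ h; simpa [inlHalf] using h

theorem inrHalf_injective : Function.Injective (inrHalf : W × Fin p → (V ⊕ W) × Fin p) := by
  rintro ⟨v, i⟩ ⟨w, j⟩ h; simpa [inrHalf] using h

theorem half_cases (h : (V ⊕ W) × Fin p) :
    (∃ x : V × Fin p, h = inlHalf x) ∨ ∃ x : W × Fin p, h = inrHalf x := by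
  rcases h with ⟨v | w, i⟩
  · exact Or.inl ⟨(v, i), rfl⟩
  · exact Or.inr ⟨(w, i), rfl⟩

theorem inlHalf_ne_inrHalf (x : V × Fin p) (y : W × Fin p) : inlHalf x ≠ inrHalf y := by
  simp [inlHalf, inrHalf]

theorem disjUnion_edge_inl (b : TraceMap p V) (b' : TraceMap p W) (h : V × Fin p) :
    (b.disjUnion b').edge (inlHalf h) = inlHalf (b.edge h) := by
  simp [disjUnion, inlHalf, Equiv.permCongr_apply]

theorem disjUnion_edge_inr (b : TraceMap p V) (b' : TraceMap p W) (h : W × Fin p) :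
    (b.disjUnion b').edge (inrHalf h) = inrHalf (b'.edge h) := by
  simp [disjUnion, inrHalf, Equiv.permCongr_apply]

theorem disjUnion_injective {b c : TraceMap p V} {b' c' : TraceMap p W}
    (h : b.disjUnion b' = c.disjUnion c') : b = c ∧ b' = c' := by
  constructor <;> ext x : 2
  · apply inlHalf_injective (W := W)
    rw [← disjUnion_edge_inl b b', h, disjUnion_edge_inl]
  · apply inrHalf_injective (V := V)
    rw [← disjUnion_edge_inr b b', h, disjUnion_edge_inr]

theorem isInvariant_range_inl (b : TraceMap p V) (b' : TraceMap p W) :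
    (b.disjUnion b').IsInvariant (Set.range Sum.inl) := by
  rintro h ⟨v, hv⟩
  obtain ⟨x, rfl⟩ | ⟨x, rfl⟩ := half_cases h
  · rw [disjUnion_edge_inl]; exact ⟨_, rfl⟩
  · simp [inrHalf] at hv

theorem exists_eq_disjUnion {b : TraceMap p (V ⊕ W)} (hb : b.IsInvariant (Set.range Sum.inl)) :
    ∃ b1 b2, b = disjUnion b1 b2 := by
  have h1 : ∀ h : V × Fin p, ∃ h' : V × Fin p, b.edge (inlHalf h) = inlHalf h' := by
    intro h
    obtain ⟨v, hv⟩ := hb (inlHalf h) ⟨_, rfl⟩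
    exact ⟨(v, _), Prod.ext hv.symm rfl⟩
  have h2 : ∀ h : W × Fin p, ∃ h' : W × Fin p, b.edge (inrHalf h) = inrHalf h' := by
    intro h
    obtain ⟨h', hh⟩ | h' := half_cases (b.edge (inrHalf h))
    · have := (hb.mem_iff (inrHalf h)).1 (hh ▸ ⟨_, rfl⟩)
      simp [inrHalf] at this
    · exact h'
  choose f hf using h1
  choose g hg using h2
  have hff : Function.Involutive f := fun h =>
    inlHalf_injective (by rw [← hf, ← hf, b.edge_edge])
  have hgg : Function.Involutive g := fun h =>
    inrHalf_injective (by rw [← hg, ← hg, b.edge_edge])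
  refine ⟨⟨hff.toPerm, hff, fun h H => b.edge_ne (inlHalf h) ?_⟩,
    ⟨hgg.toPerm, hgg, fun h H => b.edge_ne (inrHalf h) ?_⟩, ?_⟩
  · rw [hf]; exact congrArg _ H
  · rw [hg]; exact congrArg _ H
  · ext h : 2
    obtain ⟨x, rfl⟩ | ⟨x, rfl⟩ := half_cases h
    · rw [disjUnion_edge_inl, hf]; rfl
    · rw [disjUnion_edge_inr, hg]; rfl

theorem disjUnion_switch_left (b : TraceMap p V) (b' : TraceMap p W) (x y : V × Fin p) :
    (b.switch x y).disjUnion b' = (b.disjUnion b').switch (inlHalf x) (inlHalf y) := by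
  classical
  have key : ∀ h, inlHalf (W := W) (Equiv.swap x y h) =
      Equiv.swap (inlHalf x) (inlHalf y) (inlHalf h) := fun h =>
    (inlHalf_injective.map_swap x y h)
  ext h : 2
  obtain ⟨h, rfl⟩ | ⟨h, rfl⟩ := half_cases h
  · rw [disjUnion_edge_inl, switch_edge, switch_edge, key, ← disjUnion_edge_inl b b', key]
  · have : ∀ h, Equiv.swap (inlHalf x) (inlHalf y) (inrHalf h) = (inrHalf h : (V ⊕ W) × Fin p) :=
      fun h => Equiv.swap_apply_of_ne_of_ne (inlHalf_ne_inrHalf _ _).symm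
        (inlHalf_ne_inrHalf _ _).symm
    rw [switch_edge, this, disjUnion_edge_inr, disjUnion_edge_inr, this]

theorem disjUnion_switch_right (b : TraceMap p V) (b' : TraceMap p W) (x y : W × Fin p) :
    b.disjUnion (b'.switch x y) = (b.disjUnion b').switch (inrHalf x) (inrHalf y) := by
  classical
  have key : ∀ h, inrHalf (V := V) (Equiv.swap x y h) =
      Equiv.swap (inrHalf x) (inrHalf y) (inrHalf h) := fun h =>
    (inrHalf_injective.map_swap x y h)
  ext h : 2
  obtain ⟨h, rfl⟩ | ⟨h, rfl⟩ := half_cases h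
  · have : ∀ h, Equiv.swap (inrHalf x) (inrHalf y) (inlHalf h) = (inlHalf h : (V ⊕ W) × Fin p) :=
      fun h => Equiv.swap_apply_of_ne_of_ne (inlHalf_ne_inrHalf _ _)
        (inlHalf_ne_inrHalf _ _)
    rw [switch_edge, this, disjUnion_edge_inl, disjUnion_edge_inl, this]
  · rw [disjUnion_edge_inr, switch_edge, switch_edge, key, ← disjUnion_edge_inr b b', key]

theorem IsInvariant.image_inl {b : TraceMap p V} {A : Set V} (hA : b.IsInvariant A)
    (b' : TraceMap p W) : (b.disjUnion b').IsInvariant (Sum.inl '' A) := by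
  rintro h ⟨v, hv, hv'⟩
  obtain ⟨x, rfl⟩ | ⟨x, rfl⟩ := half_cases h
  · rw [disjUnion_edge_inl]
    simp only [inlHalf, Sum.inl.injEq] at hv'
    subst hv'
    exact ⟨_, hA _ hv, rfl⟩
  · simp [inrHalf] at hv'

theorem IsInvariant.image_inr {b' : TraceMap p W} {A : Set W} (hA : b'.IsInvariant A)
    (b : TraceMap p V) : (b.disjUnion b').IsInvariant (Sum.inr '' A) := by
  rintro h ⟨v, hv, hv'⟩
  obtain ⟨x, rfl⟩ | ⟨x, rfl⟩ := half_cases h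
  · simp [inlHalf] at hv'
  · rw [disjUnion_edge_inr]
    simp only [inrHalf, Sum.inr.injEq] at hv'
    subst hv'
    exact ⟨_, hA _ hv, rfl⟩

theorem reachable_inl_iff {b : TraceMap p V} {b' : TraceMap p W} {v w : V} :
    (b.disjUnion b').graph.Reachable (Sum.inl v) (Sum.inl w) ↔ b.graph.Reachable v w := by
  constructor
  · intro h
    obtain ⟨u, hu, hu'⟩ := ((b.isInvariant_reachable v).image_inl b').mem_of_reachable h
      ⟨v, SimpleGraph.Reachable.refl _, rfl⟩
    rwa [Sum.inl.inj hu'] at hu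
  · intro h
    have : b.IsInvariant {w | (b.disjUnion b').graph.Reachable (Sum.inl v) (Sum.inl w)} := by
      intro x hx
      have := (b.disjUnion b').isInvariant_reachable _ (inlHalf x) hx
      rwa [disjUnion_edge_inl] at this
    exact this.mem_of_reachable h (SimpleGraph.Reachable.refl _)

theorem reachable_inr_iff {b : TraceMap p V} {b' : TraceMap p W} {v w : W} :
    (b.disjUnion b').graph.Reachable (Sum.inr v) (Sum.inr w) ↔ b'.graph.Reachable v w := by
  constructor
  · intro h
    obtain ⟨u, hu, hu'⟩ := ((b'.isInvariant_reachable v).image_inr b).mem_of_reachable h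
      ⟨v, SimpleGraph.Reachable.refl _, rfl⟩
    rwa [Sum.inr.inj hu'] at hu
  · intro h
    have : b'.IsInvariant {w | (b.disjUnion b').graph.Reachable (Sum.inr v) (Sum.inr w)} := by
      intro x hx
      have := (b.disjUnion b').isInvariant_reachable _ (inrHalf x) hx
      rwa [disjUnion_edge_inr] at this
    exact this.mem_of_reachable h (SimpleGraph.Reachable.refl _)

theorem not_reachable_inl_inr {b : TraceMap p V} {b' : TraceMap p W} {v : V} {w : W} :
    ¬ (b.disjUnion b').graph.Reachable (Sum.inl v) (Sum.inr w) := by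
  intro h
  simpa using (isInvariant_range_inl b b').mem_of_reachable h ⟨v, rfl⟩

theorem disjUnion_le_disjUnion [Finite V] [Finite W] (hp : Even p) {b c : TraceMap p V}
    {b' c' : TraceMap p W} (h : b ≤ c) (h' : b' ≤ c') : b.disjUnion b' ≤ c.disjUnion c' := by
  have h1 : b.disjUnion b' ≤ c.disjUnion b' := by
    induction h with
    | refl => exact le_rfl
    | tail _ hs ih =>
      obtain ⟨x, y, hxy, rfl⟩ := hs.exists_switch
      refine le_trans ih (StepDown.le ?_)
      rw [disjUnion_switch_left]
      exact stepDown_switch hp (mt reachable_inl_iff.1 hxy)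
  refine le_trans h1 ?_
  clear h1
  induction h' with
  | refl => exact le_rfl
  | tail _ hs ih =>
    obtain ⟨x, y, hxy, rfl⟩ := hs.exists_switch
    refine le_trans ih (StepDown.le ?_)
    rw [disjUnion_switch_right]
    exact stepDown_switch hp (mt reachable_inr_iff.1 hxy)

theorem IsInvariant.of_le [Finite V] (hp : Even p) {b' b : TraceMap p V} (h : b' ≤ b) {A : Set V}
    (hA : b.IsInvariant A) : b'.IsInvariant A := fun x hx =>
  hA.mem_of_reachable (reachable_of_le hp h (b'.reachable_edge x)) hx

/-- Lower maps have finer components, so every map of a descending chain splits as well. A switch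
with end points on both sides would connect the two sides above it, so each step takes place on one
side. -/
theorem exists_of_le_disjUnion [Finite V] [Finite W] (hp : Even p) {b : TraceMap p (V ⊕ W)}
    {c : TraceMap p V} {c' : TraceMap p W} (h : b ≤ c.disjUnion c') :
    ∃ b1 b2, b = disjUnion b1 b2 ∧ b1 ≤ c ∧ b2 ≤ c' := by
  generalize hd : c.disjUnion c' = d at h
  induction h generalizing c c' with
  | refl => exact ⟨c, c', hd.symm, le_rfl, le_rfl⟩
  | @tail e d _ hs ih =>
    have hinv := isInvariant_range_inl c c'
    rw [hd] at hinv
    obtain ⟨e1, e2, rfl⟩ := exists_eq_disjUnion (hinv.of_le hp hs.le)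
    obtain ⟨x, y, hxy, rfl⟩ := hs.exists_switch
    have hr := reachable_switch hp hxy
    obtain ⟨x, rfl⟩ | ⟨x, rfl⟩ := half_cases x <;> obtain ⟨y, rfl⟩ | ⟨y, rfl⟩ := half_cases y
    · rw [← disjUnion_switch_left] at hd
      obtain ⟨rfl, rfl⟩ := disjUnion_injective hd
      obtain ⟨b1, b2, hb, h1, h2⟩ := ih rfl
      exact ⟨b1, b2, hb, le_trans h1 (stepDown_switch hp (mt reachable_inl_iff.2 hxy)).le, h2⟩
    · simpa [inrHalf] using hinv.mem_of_reachable hr ⟨_, rfl⟩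
    · simpa [inrHalf] using hinv.mem_of_reachable hr.symm ⟨_, rfl⟩
    · rw [← disjUnion_switch_right] at hd
      obtain ⟨rfl, rfl⟩ := disjUnion_injective hd
      obtain ⟨b1, b2, hb, h1, h2⟩ := ih rfl
      exact ⟨b1, b2, hb, h1, le_trans h2 (stepDown_switch hp (mt reachable_inr_iff.2 hxy)).le⟩

theorem disjUnion_le_iff [Finite V] [Finite W] (hp : Even p) {b c : TraceMap p V}
    {b' c' : TraceMap p W} : b.disjUnion b' ≤ c.disjUnion c' ↔ b ≤ c ∧ b' ≤ c' := by
  refine ⟨fun h => ?_, fun h => disjUnion_le_disjUnion hp h.1 h.2⟩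
  obtain ⟨b1, b2, hb, h1, h2⟩ := exists_of_le_disjUnion hp h
  obtain ⟨rfl, rfl⟩ := disjUnion_injective hb
  exact ⟨h1, h2⟩

end DisjUnion

/-! ### Sums over split maps and over order ideals -/

section GlueSum

open scoped Classical

variable {p : ℕ} {V W X : Type} [Finite V] [Finite W] [Finite X]

/-- Summation over the trace maps which split along a partition of the vertices. -/
theorem sum_isInvariant (e : V ⊕ W ≃ X) (F : TraceMap p X → ℝ) :
    ∑ b with IsInvariant b (Set.range (e ∘ Sum.inl)), F b =
      ∑ b1 : TraceMap p V, ∑ b2 : TraceMap p W, F ((b1.disjUnion b2).relabel e) := by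
  rw [← Fintype.sum_prod_type']
  symm
  refine Finset.sum_bij (fun b _ => (b.1.disjUnion b.2).relabel e) ?_ ?_ ?_ ?_
  · intro b _
    simp only [Finset.mem_filter, Finset.mem_univ, true_and]
    have := (isInvariant_range_inl b.1 b.2).map (halfEdgeEquiv_fst e)
    rwa [← Set.range_comp] at this
  · intro b _ c _ h
    exact Prod.ext_iff.2 (disjUnion_injective ((mapEquiv (halfEdgeEquiv p e)).injective h))
  · intro b hb
    simp only [Finset.mem_filter, Finset.mem_univ, true_and] at hb
    have := hb.map (vertex_symm (halfEdgeEquiv_fst e))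
    rw [← Set.range_comp] at this
    have h2 : (e.symm ∘ e ∘ Sum.inl : V → V ⊕ W) = Sum.inl := by ext; simp
    rw [h2] at this
    obtain ⟨b1, b2, h⟩ := exists_eq_disjUnion this
    refine ⟨(b1, b2), Finset.mem_univ _, ?_⟩
    simp only [relabel]
    rw [← h, map_map_symm]
  · intro b _; rfl

theorem sum_le_disjUnion (hp : Even p) (F : TraceMap p (V ⊕ W) → ℝ) (c : TraceMap p V)
    (c' : TraceMap p W) : ∑ b with b ≤ c.disjUnion c', F b =
      ∑ b1 with b1 ≤ c, ∑ b2 with b2 ≤ c', F (disjUnion b1 b2) := by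
  rw [← Finset.sum_product']
  symm
  refine Finset.sum_bij (fun b _ => b.1.disjUnion b.2) ?_ ?_ ?_ ?_
  · intro b hb
    simpa [disjUnion_le_iff hp] using hb
  · intro b _ c _ h
    exact Prod.ext_iff.2 (disjUnion_injective h)
  · intro b hb
    simp only [Finset.mem_filter, Finset.mem_univ, true_and] at hb
    obtain ⟨b1, b2, rfl, h1, h2⟩ := exists_of_le_disjUnion hp hb
    exact ⟨(b1, b2), by simp [h1, h2], rfl⟩
  · intro b _; rfl

theorem sum_le_map (hp : Even p) {σ : V ≃ W} {e : V × Fin p ≃ W × Fin p}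
    (hv : ∀ h, (e h).1 = σ h.1) (F : TraceMap p W → ℝ) (b : TraceMap p V) :
    ∑ b' with b' ≤ b.map e, F b' = ∑ b' with b' ≤ b, F (b'.map e) := by
  symm
  refine Finset.sum_bij (fun b' _ => b'.map e) ?_ ?_ ?_ ?_
  · intro b' hb'
    simpa [map_le_map_iff hp hv] using hb'
  · intro b _ c _ h
    exact (mapEquiv e).injective h
  · intro b' hb'
    refine ⟨b'.map e.symm, ?_, map_map_symm e b'⟩
    rw [← map_map_symm e b'] at hb'
    simpa [map_le_map_iff hp hv] using hb'
  · intro b' _; rfl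

end GlueSum

end TraceMap
end TensorFree

namespace TensorFree
open TraceMap

/-! ### Invariance, multiplicativity and multilinearity of free cumulants -/

section Cumulant

open scoped Classical

variable {p : ℕ} {V W ι : Type} [Finite V] [Finite W]

theorem finsum_le_eq_sum (F : TraceMap p V → ℝ) (b : TraceMap p V) :
    ∑ᶠ b' : {b' : TraceMap p V // b' ≤ b}, F b'.1 = ∑ b' with b' ≤ b, F b' := by
  rw [finsum_eq_sum_of_fintype, ← Finset.sum_subtype_eq_sum_filter]
  exact Finset.sum_congr (by ext; simp) fun _ _ => rfl

theorem sum_le_freeCumulant (f : TraceMap p V → ℝ) (b : TraceMap p V) :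
    ∑ b' with b' ≤ b, freeCumulant f b' = f b := by
  rw [← finsum_le_eq_sum, sum_freeCumulant]

theorem eq_freeCumulant_of_sum (f κ : TraceMap p V → ℝ)
    (h : ∀ b, ∑ b' with b' ≤ b, κ b' = f b) : κ = freeCumulant f :=
  eq_freeCumulant f κ fun b => by rw [finsum_le_eq_sum, h]

namespace Distribution

/-- The free cumulants of a distribution. -/
noncomputable def cumulant (φ : Distribution p ι) (c : V → ι) (b : TraceMap p V) : ℝ :=
  freeCumulant (fun b' => φ.val b' c) b

theorem sum_cumulant (φ : Distribution p ι) (c : V → ι) (b : TraceMap p V) :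
    ∑ b' with b' ≤ b, φ.cumulant c b' = φ.val b c :=
  sum_le_freeCumulant _ b

/-- Relabelling preserves the order, so the transported cumulants solve the same inversion problem,
whose solution is unique. -/
theorem cumulant_relabel (hp : Even p) (φ : Distribution p ι) (σ : V ≃ W) (c : W → ι)
    (b : TraceMap p V) : φ.cumulant c (b.relabel σ) = φ.cumulant (c ∘ σ) b := by
  refine congrFun (eq_freeCumulant_of_sum _ (fun b => φ.cumulant c (b.relabel σ)) fun b => ?_) b
  rw [φ.val_iso b _ σ _ c (isIso_relabel σ b), ← φ.sum_cumulant c]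
  exact (sum_le_map hp (halfEdgeEquiv_fst σ) (φ.cumulant c) b).symm

theorem cumulant_of_isEmpty [IsEmpty V] (φ : Distribution p ι) (c : V → ι) (b : TraceMap p V) :
    φ.cumulant c b = 1 := by
  have : Subsingleton (TraceMap p V) :=
    ⟨fun a b => TraceMap.ext (Equiv.ext fun h => isEmptyElim h.1)⟩
  rw [← φ.val_empty b c, ← φ.sum_cumulant c b, Finset.sum_filter, Fintype.sum_subsingleton _ b]
  simp

/-- The ideal below a disjoint union is a product of ideals. Both ways of expanding the value over
it have equal sums, and by induction they agree in all terms except the top one, hence also there.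
-/
theorem cumulant_disjUnion (hp : Even p) (φ : Distribution p ι) (c : V → ι) (c' : W → ι)
    (b : TraceMap p V) (b' : TraceMap p W) :
    φ.cumulant (Sum.elim c c') (b.disjUnion b') = φ.cumulant c b * φ.cumulant c' b' := by
  generalize hd : b.disjUnion b' = d
  induction d using (wellFounded_lt (α := TraceMap p (V ⊕ W))).induction generalizing b b' with
  | _ d ih =>
  subst hd
  have h1 := φ.sum_cumulant (Sum.elim c c') (b.disjUnion b')
  rw [φ.val_disjUnion, ← φ.sum_cumulant c, ← φ.sum_cumulant c', Finset.sum_mul_sum,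
    sum_le_disjUnion hp, ← Finset.sum_product', ← Finset.sum_product'] at h1
  set s := (Finset.univ.filter fun x : TraceMap p V => x ≤ b) ×ˢ
    (Finset.univ.filter fun x : TraceMap p W => x ≤ b') with hs
  have hm : (b, b') ∈ s := by simp [hs]
  rw [← Finset.add_sum_erase _ _ hm, ← Finset.add_sum_erase s (fun x =>
    φ.cumulant c x.1 * φ.cumulant c' x.2) hm] at h1
  have h2 : ∑ x ∈ s.erase (b, b'), φ.cumulant (Sum.elim c c') (x.1.disjUnion x.2) =
      ∑ x ∈ s.erase (b, b'), φ.cumulant c x.1 * φ.cumulant c' x.2 := by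
    refine Finset.sum_congr rfl fun x hx => ih _ ?_ _ _ rfl
    simp only [hs, Finset.mem_erase, Finset.mem_product, Finset.mem_filter, Finset.mem_univ,
      true_and] at hx
    refine lt_of_le_of_ne (disjUnion_le_disjUnion hp hx.2.1 hx.2.2) fun H => hx.1 ?_
    exact Prod.ext_iff.2 (disjUnion_injective H)
  linarith

/-- Möbius inversion is linear in the function that is inverted. -/
theorem cumulant_sum [Finite ι] (φ : Distribution p ι) (b : TraceMap p V) :
    φ.sum.cumulant (fun _ => ()) b = ∑ᶠ c : V → ι, φ.cumulant c b := by
  have : Fintype ι := Fintype.ofFinite ι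
  have : Fintype V := Fintype.ofFinite V
  refine (congrFun (eq_freeCumulant_of_sum _ (fun b => ∑ᶠ c : V → ι, φ.cumulant c b)
    fun b => ?_) b).symm
  simp only [finsum_eq_sum_of_fintype, sum]
  rw [Finset.sum_comm]
  simp only [φ.sum_cumulant]

end Distribution

end Cumulant

namespace TraceMap

/-! ### Opening one edge of a connected map -/

section Count

open scoped Classical

variable {p : ℕ} {V : Type} [Finite V]

theorem isConnected_switch (hp : Even p) {b : TraceMap p V} {x y : V × Fin p}
    (hxy : ¬ b.graph.Reachable x.1 y.1) :
    (b.switch x y).IsConnected ↔ ∀ v, b.graph.Reachable x.1 v ∨ b.graph.Reachable y.1 v := by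
  rw [isConnected_iff _ x.1]
  refine forall_congr' fun v => ?_
  rw [reachable_switch_iff hp hxy]
  have := SimpleGraph.Reachable.refl (G := b.graph) x.1
  tauto

/-- The connected maps above `b₀` which contain given edges of `b₀` are counted by opening the
edge at `x`: a connected map without the edge of `b₀` at `x` arises in a unique way by joining
this edge to an edge of another connected component. -/
theorem card_connected_above (hp : Even p) (b₀ : TraceMap p V) {S : Set (V × Fin p)}
    {x : V × Fin p} (hS : ∀ s ∈ S, b₀.edge s ∈ S) (hx : x ∉ S)
    (hr : ∀ s ∈ S, b₀.graph.Reachable x.1 s.1) [Fintype (V × Fin p)] :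
    (Finset.univ.filter fun b : TraceMap p V =>
      b.IsConnected ∧ b₀ ≤ b ∧ ∀ s ∈ S, b.edge s = b₀.edge s).card =
    (Finset.univ.filter fun b : TraceMap p V =>
      b.IsConnected ∧ b₀ ≤ b ∧ ∀ s ∈ insert x (insert (b₀.edge x) S), b.edge s = b₀.edge s).card +
    (Finset.univ.filter fun q : TraceMap p V × (V × Fin p) =>
      (¬ q.1.graph.Reachable x.1 q.2.1 ∧
        ∀ v, q.1.graph.Reachable x.1 v ∨ q.1.graph.Reachable q.2.1 v) ∧
      b₀ ≤ q.1 ∧ ∀ s ∈ insert x (insert (b₀.edge x) S), q.1.edge s = b₀.edge s).card := by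
  have hins : ∀ b : TraceMap p V, (∀ s ∈ insert x (insert (b₀.edge x) S), b.edge s = b₀.edge s) ↔
      b.edge x = b₀.edge x ∧ ∀ s ∈ S, b.edge s = b₀.edge s := by
    intro b
    simp only [Set.mem_insert_iff, forall_eq_or_imp, b₀.edge_edge]
    refine and_congr_right fun h => ?_
    rw [← h, b.edge_edge]
    simp
  simp only [hins]
  rw [← Finset.card_filter_add_card_filter_not (p := fun b => b.edge x = b₀.edge x),
    Finset.filter_filter, Finset.filter_filter]
  congr 1
  · congr 1
    ext b
    simp only [Finset.mem_filter, Finset.mem_univ, true_and]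
    tauto
  set x' := b₀.edge x with hx'
  have hx'S : x' ∉ S := fun h => hx (by simpa [hx', b₀.edge_edge] using hS _ h)
  have hxx' : x ≠ x' := fun h => b₀.edge_ne x h.symm
  -- The second entry remembers the former partner of `x`; switching it with `x'` once more recovers
  -- `b`.
  refine Finset.card_bij' (fun b _ => (b.switch x' (b.edge x), b.edge x))
    (fun q _ => q.1.switch x' q.2) ?_ ?_ ?_ ?_
  · intro b hb
    simp only [Finset.mem_filter, Finset.mem_univ, true_and] at hb ⊢
    obtain ⟨⟨hconn, hle, hbS⟩, hne⟩ := hb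
    obtain ⟨h1, h2⟩ := restore_edge hp hle hne
    have hnr : ¬ (b.switch x' (b.edge x)).graph.Reachable x'.1 (b.edge x).1 := by
      apply StepDown.not_reachable
      rwa [switch_switch]
    have hnx : b.edge x' ≠ b.edge x := fun H => hxx' (b.edge.injective H).symm
    have hex : (b.switch x' (b.edge x)).edge x = x' := by
      have := switch_edge_edge_right hnx
      rwa [b.edge_edge] at this
    have hxr : ∀ v, (b.switch x' (b.edge x)).graph.Reachable x.1 v ↔
        (b.switch x' (b.edge x)).graph.Reachable x'.1 v := by
      have := (b.switch x' (b.edge x)).reachable_edge x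
      rw [hex] at this
      exact fun v => ⟨fun H => this.symm.trans H, fun H => this.trans H⟩
    simp only [hxr]
    refine ⟨⟨hnr, ?_⟩, h1, hex, ?_⟩
    · rw [← isConnected_switch hp hnr, switch_switch]
      exact hconn
    · intro s hs
      rw [switch_edge_of_ne, hbS s hs]
      · rintro rfl; exact hx'S hs
      · rintro rfl
        have h3 := hbS _ hs
        rw [b.edge_edge] at h3
        exact hx (h3 ▸ hS _ hs)
      · intro H
        have h3 := hbS s hs
        rw [H, b.edge_edge, ← H] at h3
        apply hx'S
        rw [h3]
        exact hS s hs
      · rw [b.edge_edge]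
        rintro rfl; exact hx hs
  · rintro ⟨b, y⟩ hb
    simp only [Finset.mem_filter, Finset.mem_univ, true_and] at hb ⊢
    obtain ⟨⟨h1, h2⟩, hle, hbx, hbS⟩ := hb
    have hxr : b.graph.Reachable x'.1 x.1 := hbx ▸ (b.reachable_edge x).symm
    have hny : ¬ b.graph.Reachable x'.1 y.1 := fun H => h1 (hxr.symm.trans H)
    have hx'y : b.edge x' ≠ y := by
      rintro rfl; exact hny (b.reachable_edge x')
    have hby : (b.switch x' y).edge x = y := by
      have := switch_edge_edge_left hx'y
      rwa [← hbx, b.edge_edge, hbx] at this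
    refine ⟨⟨?_, le_trans hle (stepDown_switch hp hny).le, ?_⟩, ?_⟩
    · rw [isConnected_switch hp hny]
      exact fun v => (h2 v).imp (fun H => hxr.trans H) id
    · intro s hs
      -- By `hr` the half-edges in `S` lie in the component of `x`, so neither `y` nor `b.edge y` is
      -- among them and joining at `y` keeps the edges at `S`.
      have hsr : b.graph.Reachable x.1 s.1 := reachable_of_le hp hle (hr s hs)
      rw [switch_edge_of_ne, hbS s hs]
      · rintro rfl; exact hx'S hs
      · rintro rfl; exact h1 hsr
      · rintro rfl
        rw [← hbx, b.edge_edge] at hs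
        exact hx hs
      · rintro rfl
        exact h1 ((b.reachable_edge_edge).1 hsr)
    · rw [hby]
      rintro rfl
      exact hny (SimpleGraph.Reachable.refl _)
  · intro b hb
    simp
  · rintro ⟨b, y⟩ hb
    simp only [Finset.mem_filter, Finset.mem_univ, true_and] at hb ⊢
    obtain ⟨⟨h1, h2⟩, hle, hbx, hbS⟩ := hb
    have hxr : b.graph.Reachable x'.1 x.1 := hbx ▸ (b.reachable_edge x).symm
    have hx'y : b.edge x' ≠ y := by
      rintro rfl; exact h1 (hxr.symm.trans (b.reachable_edge x'))
    have hby : (b.switch x' y).edge x = y := by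
      have := switch_edge_edge_left hx'y
      rwa [← hbx, b.edge_edge, hbx] at this
    rw [hby, switch_switch]

end Count

end TraceMap
end TensorFree

/-! ### Weighted counts of connected maps above a fixed component -/

namespace TensorFree
open TraceMap

namespace Distribution

open scoped Classical

variable {p : ℕ} {V W C U : Type} [Finite V] [Finite W] [Finite C] [Finite U]

/-- The trace invariant of a single tensor. -/
def value (a : Distribution p Unit) (b : TraceMap p V) : ℝ := a.val b fun _ => ()

/-- The free cumulant of a single tensor. -/
noncomputable def kappa (a : Distribution p Unit) (b : TraceMap p V) : ℝ :=
  a.cumulant (fun _ => ()) b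

variable (a : Distribution p Unit)

theorem sum_kappa (b : TraceMap p V) : ∑ b' with b' ≤ b, a.kappa b' = a.value b :=
  a.sum_cumulant _ b

theorem value_relabel (σ : V ≃ W) (b : TraceMap p V) : a.value (b.relabel σ) = a.value b :=
  (a.val_iso b _ σ _ _ (isIso_relabel σ b)).symm

theorem kappa_relabel (hp : Even p) (σ : V ≃ W) (b : TraceMap p V) :
    a.kappa (b.relabel σ) = a.kappa b := a.cumulant_relabel hp σ _ b

theorem kappa_disjUnion (hp : Even p) (b : TraceMap p V) (b' : TraceMap p W) :
    a.kappa (b.disjUnion b') = a.kappa b * a.kappa b' := by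
  rw [kappa, kappa, kappa, ← a.cumulant_disjUnion hp]

theorem kappa_of_isEmpty [IsEmpty V] (b : TraceMap p V) : a.kappa b = 1 :=
  a.cumulant_of_isEmpty _ b

/-- The sum of the trace invariants of all connected maps with `n` labelled vertices. -/
noncomputable def connSum (n : ℕ) : ℝ :=
  ∑ b : TraceMap p (Fin n) with b.IsConnected, a.value b

/-- The sum of the free cumulants of all connected maps with `n` labelled vertices. -/
noncomputable def connCum (n : ℕ) : ℝ :=
  ∑ b : TraceMap p (Fin n) with b.IsConnected, a.kappa b

theorem sum_connected_relabel (σ : V ≃ W) (F : TraceMap p V → ℝ) (G : TraceMap p W → ℝ)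
    (h : ∀ b, G (b.relabel σ) = F b) :
    ∑ b with TraceMap.IsConnected b, F b = ∑ b with TraceMap.IsConnected b, G b := by
  rw [Finset.sum_filter, Finset.sum_filter]
  refine Fintype.sum_equiv (mapEquiv (halfEdgeEquiv p σ)) _ _ fun b => ?_
  rw [← h]
  simp only [mapEquiv_apply, relabel, isConnected_map_iff (halfEdgeEquiv_fst σ)]

theorem sum_connected_value :
    ∑ b : TraceMap p V with b.IsConnected, a.value b = a.connSum (Nat.card V) :=
  sum_connected_relabel (Finite.equivFin V) _ _ (a.value_relabel _)

theorem sum_connected_kappa (hp : Even p) :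
    ∑ b : TraceMap p V with b.IsConnected, a.kappa b = a.connCum (Nat.card V) :=
  sum_connected_relabel (Finite.equivFin V) _ _ (a.kappa_relabel hp _)

/-- The sum of the free cumulants of all `b'` for which the disjoint union of `c` and `b'` lies
below `b`. -/
noncomputable def weight (c : TraceMap p C) (b : TraceMap p (C ⊕ U)) : ℝ :=
  ∑ b' with c.disjUnion b' ≤ b, a.kappa b'

/-- The contribution of the connected maps that contain the edges of `c` at the half-edges
in `S`. -/
noncomputable def connWeight (c : TraceMap p C) (S : Set (C × Fin p)) (U : Type) [Finite U] : ℝ :=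
  ∑ b : TraceMap p (C ⊕ U) with
    b.IsConnected ∧ ∀ s ∈ S, b.edge (inlHalf s) = inlHalf (c.edge s), a.weight c b

/-- Exchanging the two summations isolates, for each `b'`, a count to which `card_connected_above`
applies. -/
theorem connWeight_eq (c : TraceMap p C) (S : Set (C × Fin p)) :
    a.connWeight c S U = ∑ b' : TraceMap p U, a.kappa b' *
      (Finset.univ.filter fun b : TraceMap p (C ⊕ U) => b.IsConnected ∧ c.disjUnion b' ≤ b ∧
        ∀ s ∈ S, b.edge (inlHalf s) = inlHalf (c.edge s)).card := by
  simp only [connWeight, weight, Finset.sum_filter]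
  have : ∀ b : TraceMap p (C ⊕ U), (if b.IsConnected ∧
      ∀ s ∈ S, b.edge (inlHalf s) = inlHalf (c.edge s) then
        ∑ b' : TraceMap p U, if c.disjUnion b' ≤ b then a.kappa b' else 0 else 0) =
      ∑ b' : TraceMap p U, if b.IsConnected ∧ c.disjUnion b' ≤ b ∧
        ∀ s ∈ S, b.edge (inlHalf s) = inlHalf (c.edge s) then a.kappa b' else 0 := by
    intro b
    split_ifs with h
    · refine Finset.sum_congr rfl fun b' _ => ?_
      have : (b.IsConnected ∧ c.disjUnion b' ≤ b ∧
        ∀ s ∈ S, b.edge (inlHalf s) = inlHalf (c.edge s)) ↔ c.disjUnion b' ≤ b := by tauto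
      simp only [this]
    · symm
      refine Finset.sum_eq_zero fun b' _ => if_neg ?_
      tauto
  rw [Finset.sum_congr rfl fun b _ => this b, Finset.sum_comm]
  refine Finset.sum_congr rfl fun b' _ => ?_
  rw [← Finset.sum_filter, Finset.sum_const, nsmul_eq_mul, mul_comm]

/-- Regrouping of the vertices along a subset of the second summand. -/
noncomputable def splitEquiv (C : Type) (D : Set U) : (C ⊕ {u // u ∈ D}) ⊕ {u // u ∉ D} ≃ C ⊕ U :=
  (Equiv.sumAssoc _ _ _).trans (Equiv.sumCongr (Equiv.refl _) (Equiv.sumCompl (· ∈ D)))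

omit [Finite U] [Finite C] in
theorem disjUnion_relabel_sumCompl (D : Set U) (c : TraceMap p C) (b1 : TraceMap p {u // u ∈ D})
    (b2 : TraceMap p {u // u ∉ D}) :
    c.disjUnion ((b1.disjUnion b2).relabel (Equiv.sumCompl (· ∈ D))) =
      ((c.disjUnion b1).disjUnion b2).relabel (splitEquiv C D) := by
  ext h : 2
  obtain ⟨h, rfl⟩ := (halfEdgeEquiv p (splitEquiv C D)).surjective h
  rw [relabel, relabel, map_edge]
  obtain ⟨h, rfl⟩ | ⟨h, rfl⟩ := half_cases h
  · obtain ⟨h, rfl⟩ | ⟨h, rfl⟩ := half_cases h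
    · rw [disjUnion_edge_inl, disjUnion_edge_inl]
      exact disjUnion_edge_inl _ _ h
    · rw [disjUnion_edge_inl, disjUnion_edge_inr]
      have := disjUnion_edge_inr c ((b1.disjUnion b2).map (halfEdgeEquiv p
        (Equiv.sumCompl (· ∈ D)))) (halfEdgeEquiv p (Equiv.sumCompl (· ∈ D)) (inlHalf h))
      rw [map_edge, disjUnion_edge_inl] at this
      exact this
  · rw [disjUnion_edge_inr]
    have := disjUnion_edge_inr c ((b1.disjUnion b2).map (halfEdgeEquiv p
        (Equiv.sumCompl (· ∈ D)))) (halfEdgeEquiv p (Equiv.sumCompl (· ∈ D)) (inrHalf h))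
    rw [map_edge, disjUnion_edge_inr] at this
    exact this

/-- The ideal below a disjoint union is a product and the cumulants are multiplicative. On the part
without `c` there is no constraint besides lying below `b2`, so its cumulants add up to a trace
invariant. -/
theorem weight_glue (hp : Even p) (D : Set U) (c : TraceMap p C)
    (b1 : TraceMap p (C ⊕ {u // u ∈ D})) (b2 : TraceMap p {u // u ∉ D}) :
    a.weight c ((b1.disjUnion b2).relabel (splitEquiv C D)) = a.weight c b1 * a.value b2 := by
  set B := (b1.disjUnion b2).relabel (splitEquiv C D) with hB
  -- Since `B` splits along `D`, so does every map below it; the restriction to such `b'` loses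
  -- nothing.
  have h1 : a.weight c B = ∑ b' : TraceMap p U with
      b'.IsInvariant (Set.range (Equiv.sumCompl (· ∈ D) ∘ Sum.inl)),
      if c.disjUnion b' ≤ B then a.kappa b' else 0 := by
    rw [weight, Finset.sum_filter, Finset.sum_filter]
    refine Finset.sum_congr rfl fun b' _ => ?_
    by_cases h : c.disjUnion b' ≤ B
    · rw [if_pos h, if_pos]
      have hinv := (isInvariant_range_inl b1 b2).map (halfEdgeEquiv_fst (splitEquiv C D))
      rintro x ⟨u, hu⟩
      have := hinv.of_le hp h (inrHalf x) ⟨Sum.inl (Sum.inr u), ⟨_, rfl⟩, congrArg Sum.inr hu⟩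
      rw [disjUnion_edge_inr] at this
      obtain ⟨_, ⟨v, rfl⟩, hv⟩ := this
      rcases v with v | v
      · simp [splitEquiv, inrHalf] at hv
      · exact ⟨v, by simpa [splitEquiv, inrHalf] using hv⟩
    · simp [if_neg h]
  rw [h1, sum_isInvariant, weight, ← sum_kappa, Finset.sum_mul_sum, Finset.sum_filter]
  refine Finset.sum_congr rfl fun c1 _ => ?_
  rw [Finset.sum_filter]
  have : ∀ c2 : TraceMap p {u // u ∉ D}, (c.disjUnion ((c1.disjUnion c2).relabel
      (Equiv.sumCompl (· ∈ D))) ≤ B) ↔ c.disjUnion c1 ≤ b1 ∧ c2 ≤ b2 := by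
    intro c2
    rw [disjUnion_relabel_sumCompl, hB, relabel, relabel, map_le_map_iff hp (halfEdgeEquiv_fst _),
      disjUnion_le_iff hp]
  simp only [this, kappa_relabel a hp, kappa_disjUnion a hp]
  by_cases h : c.disjUnion c1 ≤ b1 <;> simp [h]

/-- These `y` are the places where the part away from the root can be attached: all of its
half-edges, provided that both parts are connected. -/
theorem card_glue [Fintype ((C ⊕ U) × Fin p)] (D : Set U)
    (b1 : TraceMap p (C ⊕ {u // u ∈ D})) (b2 : TraceMap p {u // u ∉ D}) (x : C)
    (hx : ∀ v, b1.graph.Reachable (Sum.inl x) (Sum.inl v)) :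
    (Finset.univ.filter fun y : (C ⊕ U) × Fin p =>
      let B := (b1.disjUnion b2).relabel (splitEquiv C D)
      (∀ u, B.graph.Reachable (Sum.inl x) (Sum.inr u) ↔ u ∈ D) ∧
      ¬ B.graph.Reachable (Sum.inl x) y.1 ∧
        ∀ v, B.graph.Reachable (Sum.inl x) v ∨ B.graph.Reachable y.1 v).card =
    if b1.IsConnected ∧ b2.IsConnected then Nat.card {u // u ∉ D} * p else 0 := by
  set B := (b1.disjUnion b2).relabel (splitEquiv C D) with hB
  set e := splitEquiv C D with he
  have hR : ∀ v w, B.graph.Reachable (e v) (e w) ↔ (b1.disjUnion b2).graph.Reachable v w :=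
    fun v w => reachable_map_iff (halfEdgeEquiv_fst e)
  have hxe : (Sum.inl x : C ⊕ U) = e (Sum.inl (Sum.inl x)) := rfl
  have hD : ∀ u : {u // u ∈ D}, (Sum.inr u.1 : C ⊕ U) = e (Sum.inl (Sum.inr u)) := fun _ => rfl
  have hD' : ∀ u : {u // u ∉ D}, (Sum.inr u.1 : C ⊕ U) = e (Sum.inr u) := fun _ => rfl
  split_ifs with h
  · obtain ⟨h1, h2⟩ := h
    have : (Finset.univ.filter fun y : (C ⊕ U) × Fin p =>
      (∀ u, B.graph.Reachable (Sum.inl x) (Sum.inr u) ↔ u ∈ D) ∧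
      ¬ B.graph.Reachable (Sum.inl x) y.1 ∧
        ∀ v, B.graph.Reachable (Sum.inl x) v ∨ B.graph.Reachable y.1 v) =
        (Set.range fun y : {u // u ∉ D} × Fin p =>
          halfEdgeEquiv p e (inrHalf y)).toFinite.toFinset := by
      ext y
      simp only [Finset.mem_filter, Finset.mem_univ, true_and, Set.Finite.mem_toFinset,
        Set.mem_range]
      constructor
      · rintro ⟨-, hy, -⟩
        obtain ⟨y, rfl⟩ := (halfEdgeEquiv p e).surjective y
        obtain ⟨y, rfl⟩ | ⟨y, rfl⟩ := half_cases y
        · exfalso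
          apply hy
          rw [halfEdgeEquiv_fst, hxe, hR]
          exact reachable_inl_iff.2 (h1.preconnected _ _)
        · exact ⟨y, rfl⟩
      · rintro ⟨y, rfl⟩
        refine ⟨fun u => ?_, ?_, ?_⟩
        · by_cases hu : u ∈ D
          · simp only [hu, iff_true]
            rw [hD ⟨u, hu⟩, hxe, hR]
            exact reachable_inl_iff.2 (h1.preconnected _ _)
          · simp only [hu, iff_false]
            rw [hD' ⟨u, hu⟩, hxe, hR]
            exact not_reachable_inl_inr
        · rw [halfEdgeEquiv_fst, hxe, hR]
          exact not_reachable_inl_inr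
        · intro v
          obtain ⟨v, rfl⟩ := e.surjective v
          rw [halfEdgeEquiv_fst, hxe, hR, hR]
          rcases v with v | v
          · exact Or.inl (reachable_inl_iff.2 (h1.preconnected _ _))
          · exact Or.inr (reachable_inr_iff.2 (h2.preconnected _ _))
    simp only [this]
    rw [← Set.ncard_eq_toFinset_card, Set.ncard_range_of_injective]
    · rw [Nat.card_prod, Nat.card_fin]
    · exact (halfEdgeEquiv p e).injective.comp inrHalf_injective
  · rw [Finset.card_eq_zero, Finset.filter_eq_empty_iff]
    rintro y - ⟨hy1, hy2, hy3⟩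
    apply h
    have h1 : b1.IsConnected := by
      rw [isConnected_iff _ (Sum.inl x)]
      rintro (v | v)
      · exact hx v
      · have := (hy1 v.1).2 v.2
        rwa [hD, hxe, hR, reachable_inl_iff] at this
    refine ⟨h1, ?_⟩
    obtain ⟨y, rfl⟩ := (halfEdgeEquiv p e).surjective y
    rw [halfEdgeEquiv_fst] at hy2 hy3
    obtain ⟨y, rfl⟩ | ⟨y, rfl⟩ := half_cases y
    · exfalso
      apply hy2
      rw [hxe, hR]
      exact reachable_inl_iff.2 (h1.preconnected _ _)
    · rw [isConnected_iff _ y.1]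
      intro w
      have := (hy3 (e (Sum.inr w))).resolve_left ?_
      · rw [hR] at this
        exact reachable_inr_iff.1 this
      · rw [hxe, hR]
        exact not_reachable_inl_inr

end Distribution
end TensorFree

namespace TensorFree
open TraceMap

namespace Distribution

open scoped Classical

variable {p : ℕ} {V W C U : Type} [Finite V] [Finite W] [Finite C] [Finite U]
variable (a : Distribution p Unit)

/-- A map above `c.disjUnion b'` keeps `C` inside one component. Therefore maps that separate `C`
may be included in sums or left out at will. -/
theorem weight_eq_zero (hp : Even p) {c : TraceMap p C} (hc : c.IsConnected)
    {b : TraceMap p (C ⊕ U)} {x : C}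
    (h : ¬ ∀ v, b.graph.Reachable (Sum.inl x) (Sum.inl v)) : a.weight c b = 0 := by
  refine Finset.sum_eq_zero fun b' hb' => (h fun v => ?_).elim
  simp only [Finset.mem_filter, Finset.mem_univ, true_and] at hb'
  exact reachable_of_le hp hb' (reachable_inl_iff.2 (hc.preconnected _ _))

/-- Either the edge of `c` at `x` is present, or restoring it cuts the map in two: the root part
lives on `C` and `D`, and the rest is a connected map attached at any of its half-edges. -/
theorem connWeight_step (hp : Even p) {c : TraceMap p C} (hc : c.IsConnected)
    {S : Set (C × Fin p)} {x : C × Fin p} (hS : ∀ s ∈ S, c.edge s ∈ S) (hx : x ∉ S) :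
    a.connWeight c S U = a.connWeight c (insert x (insert (c.edge x) S)) U +
      ∑ᶠ D : Set U, a.connWeight c (insert x (insert (c.edge x) S)) {u // u ∈ D} *
        ((Nat.card {u // u ∉ D} * p : ℕ) * a.connSum (Nat.card {u // u ∉ D})) := by
  have : Fintype ((C ⊕ U) × Fin p) := Fintype.ofFinite _
  set F := insert x (insert (c.edge x) S) with hF
  have himage : ∀ (b' : TraceMap p U) (b : TraceMap p (C ⊕ U)) (T : Set (C × Fin p)),
      (∀ s ∈ inlHalf '' T, b.edge s = (c.disjUnion b').edge s) ↔
      ∀ s ∈ T, b.edge (inlHalf s) = inlHalf (c.edge s) := by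
    intro b' b T
    rw [Set.forall_mem_image]
    simp only [disjUnion_edge_inl]
  have key : ∀ b' : TraceMap p U, _ := fun b' =>
    card_connected_above hp (c.disjUnion b') (S := inlHalf '' S) (x := inlHalf x)
    (by
      rintro _ ⟨s, hs, rfl⟩
      rw [disjUnion_edge_inl]
      exact ⟨_, hS s hs, rfl⟩)
    (by
      rintro ⟨s, hs, h⟩
      exact hx (inlHalf_injective h ▸ hs))
    (by
      rintro _ ⟨s, hs, rfl⟩
      exact reachable_inl_iff.2 (hc.preconnected _ _))
  simp only [disjUnion_edge_inl, ← Set.image_insert_eq, himage] at key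
  rw [a.connWeight_eq, a.connWeight_eq, Finset.sum_congr rfl fun b' _ =>
    congrArg (fun n : ℕ => a.kappa b' * n) (key b')]
  simp only [Nat.cast_add, mul_add, Finset.sum_add_distrib]
  congr 1
  -- group the pairs by the vertices of `U` in the component of the root
  have h1 : ∀ b' : TraceMap p U, (a.kappa b' * ((Finset.univ.filter
      fun q : TraceMap p (C ⊕ U) × ((C ⊕ U) × Fin p) =>
      (¬ q.1.graph.Reachable (inlHalf x).1 q.2.1 ∧
        ∀ v, q.1.graph.Reachable (inlHalf x).1 v ∨ q.1.graph.Reachable q.2.1 v) ∧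
      c.disjUnion b' ≤ q.1 ∧ ∀ s ∈ F, q.1.edge (inlHalf s) = inlHalf (c.edge s)).card : ℝ)) =
      ∑ q : TraceMap p (C ⊕ U) × ((C ⊕ U) × Fin p),
        if (¬ q.1.graph.Reachable (inlHalf x).1 q.2.1 ∧
          ∀ v, q.1.graph.Reachable (inlHalf x).1 v ∨ q.1.graph.Reachable q.2.1 v) ∧
          ∀ s ∈ F, q.1.edge (inlHalf s) = inlHalf (c.edge s) then
          if c.disjUnion b' ≤ q.1 then a.kappa b' else 0 else 0 := by
    intro b'
    rw [mul_comm, ← nsmul_eq_mul, ← Finset.sum_const, Finset.sum_filter]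
    refine Finset.sum_congr rfl fun q _ => ?_
    rw [← ite_and]
    congr 1
    exact propext (by tauto)
  rw [Finset.sum_congr rfl fun b' _ => h1 b', Finset.sum_comm]
  have : Fintype U := Fintype.ofFinite U
  rw [finsum_eq_sum_of_fintype]
  have h2 : ∀ q : TraceMap p (C ⊕ U) × ((C ⊕ U) × Fin p),
      (∑ b' : TraceMap p U, if (¬ q.1.graph.Reachable (inlHalf x).1 q.2.1 ∧
          ∀ v, q.1.graph.Reachable (inlHalf x).1 v ∨ q.1.graph.Reachable q.2.1 v) ∧
          ∀ s ∈ F, q.1.edge (inlHalf s) = inlHalf (c.edge s) then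
          if c.disjUnion b' ≤ q.1 then a.kappa b' else 0 else 0) =
      ∑ D : Set U, if (∀ u, q.1.graph.Reachable (Sum.inl x.1) (Sum.inr u) ↔ u ∈ D) ∧
        ¬ q.1.graph.Reachable (Sum.inl x.1) q.2.1 ∧
          ∀ v, q.1.graph.Reachable (Sum.inl x.1) v ∨ q.1.graph.Reachable q.2.1 v then
          if ∀ s ∈ F, q.1.edge (inlHalf s) = inlHalf (c.edge s) then a.weight c q.1 else 0
        else 0 := by
    intro q
    rw [Finset.sum_eq_single {u | q.1.graph.Reachable (Sum.inl x.1) (Sum.inr u)}]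
    · simp only [Set.mem_ofPred_eq, implies_true, true_and]
      rw [← ite_and]
      by_cases h : (¬ q.1.graph.Reachable (inlHalf x).1 q.2.1 ∧
          ∀ v, q.1.graph.Reachable (inlHalf x).1 v ∨ q.1.graph.Reachable q.2.1 v) ∧
          ∀ s ∈ F, q.1.edge (inlHalf s) = inlHalf (c.edge s)
      · simp only [if_pos h]
        rw [← Finset.sum_filter]
        exact (if_pos h).symm
      · simp only [if_neg h, Finset.sum_const_zero]
        exact (if_neg h).symm
    · intro D _ hD
      refine if_neg fun h => hD ?_
      ext u
      exact (h.1 u).symm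
    · simp
  rw [Finset.sum_congr rfl fun q _ => h2 q, Finset.sum_comm]
  refine Finset.sum_congr rfl fun D _ => ?_
  rw [Fintype.sum_prod_type]
  have h3 : ∀ b : TraceMap p (C ⊕ U), (∑ y : (C ⊕ U) × Fin p,
      if (∀ u, b.graph.Reachable (Sum.inl x.1) (Sum.inr u) ↔ u ∈ D) ∧
        ¬ b.graph.Reachable (Sum.inl x.1) y.1 ∧
          ∀ v, b.graph.Reachable (Sum.inl x.1) v ∨ b.graph.Reachable y.1 v then
          if ∀ s ∈ F, b.edge (inlHalf s) = inlHalf (c.edge s) then a.weight c b else 0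
        else 0) = if b.IsInvariant (Set.range (splitEquiv C D ∘ Sum.inl)) then
      ((Finset.univ.filter fun y : (C ⊕ U) × Fin p =>
        (∀ u, b.graph.Reachable (Sum.inl x.1) (Sum.inr u) ↔ u ∈ D) ∧
        ¬ b.graph.Reachable (Sum.inl x.1) y.1 ∧
          ∀ v, b.graph.Reachable (Sum.inl x.1) v ∨ b.graph.Reachable y.1 v).card : ℝ) *
        (if ∀ s ∈ F, b.edge (inlHalf s) = inlHalf (c.edge s) then a.weight c b else 0) else 0 := by
    intro b
    rw [← Finset.sum_filter, Finset.sum_const, nsmul_eq_mul]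
    by_cases h' : b.IsInvariant (Set.range (splitEquiv C D ∘ Sum.inl))
    · rw [if_pos h']
    · rw [if_neg h']
      by_cases hr : ∀ v, b.graph.Reachable (Sum.inl x.1) (Sum.inl v)
      · rw [Finset.filter_false_of_mem, Finset.card_empty, Nat.cast_zero, zero_mul]
        rintro y - ⟨hy, -⟩
        apply h'
        have : Set.range (splitEquiv C D ∘ Sum.inl) =
            {v | b.graph.Reachable (Sum.inl x.1) v} := by
          ext v
          obtain ⟨v, rfl⟩ := (splitEquiv C D).surjective v
          rcases v with (v | v) | v
          · simp [splitEquiv, hr]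
          · simp [splitEquiv, hy, v.2]
          · simp [splitEquiv, hy, v.2]
        rw [this]
        exact b.isInvariant_reachable _
      · rw [a.weight_eq_zero hp hc hr, ite_self, mul_zero]
  rw [Finset.sum_congr rfl fun b _ => h3 b, ← Finset.sum_filter, sum_isInvariant, connWeight,
    ← a.sum_connected_value, Finset.mul_sum, Finset.sum_mul_sum, Finset.sum_filter]
  refine Finset.sum_congr rfl fun b1 _ => ?_
  have h4 : ∀ b2 : TraceMap p {u // u ∉ D}, (∀ s ∈ F, ((b1.disjUnion b2).relabel
      (splitEquiv C D)).edge (inlHalf s) = inlHalf (c.edge s)) ↔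
      ∀ s ∈ F, b1.edge (inlHalf s) = inlHalf (c.edge s) := by
    intro b2
    refine forall₂_congr fun s _ => ?_
    have : (inlHalf s : (C ⊕ U) × Fin p) = halfEdgeEquiv p (splitEquiv C D)
      (inlHalf (inlHalf s)) := rfl
    rw [this, relabel, map_edge, disjUnion_edge_inl]
    have : (inlHalf (c.edge s) : (C ⊕ U) × Fin p) = halfEdgeEquiv p (splitEquiv C D)
      (inlHalf (inlHalf (c.edge s))) := rfl
    rw [this, (halfEdgeEquiv p (splitEquiv C D)).injective.eq_iff, inlHalf_injective.eq_iff]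
  simp only [h4, a.weight_glue hp]
  by_cases hr : ∀ v, b1.graph.Reachable (Sum.inl x.1) (Sum.inl v)
  · have h5 := fun b2 => card_glue D b1 b2 x.1 hr
    simp only at h5
    simp only [h5]
    rw [ite_and, Finset.sum_filter]
    by_cases hb1 : b1.IsConnected
    · by_cases hb : ∀ s ∈ F, b1.edge (inlHalf s) = inlHalf (c.edge s)
      · rw [if_pos hb1, if_pos hb]
        refine Finset.sum_congr rfl fun b2 _ => ?_
        rw [if_pos hb]
        by_cases hb2 : b2.IsConnected
        · rw [if_pos ⟨hb1, hb2⟩, if_pos hb2]; ring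
        · rw [if_neg (fun h => hb2 h.2), if_neg hb2]; simp
      · simp only [if_neg hb, mul_zero, Finset.sum_const_zero, ite_self]
    · simp [hb1]
  · rw [a.weight_eq_zero hp hc hr]
    simp

/-- If all edges of `c` are present, `C` is a union of components, and connectedness leaves no room
for vertices in `U`. -/
theorem connWeight_univ {c : TraceMap p C} (hc : c.IsConnected) :
    a.connWeight c Set.univ U = if Nat.card U = 0 then 1 else 0 := by
  obtain ⟨v⟩ := hc.nonempty
  have hinv : ∀ b : TraceMap p (C ⊕ U), (∀ s ∈ Set.univ, b.edge (inlHalf s) =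
      inlHalf (c.edge s)) → b.IsInvariant (Set.range Sum.inl) := by
    rintro b hb ⟨_, i⟩ ⟨w, rfl⟩
    have := hb (w, i) trivial
    exact ⟨_, (congrArg Prod.fst this).symm⟩
  split_ifs with hU
  · have hU : IsEmpty U := by
      rcases Finite.card_eq_zero_iff.1 hU with h; exact h
    have : Subsingleton (TraceMap p U) :=
      ⟨fun a b => TraceMap.ext (Equiv.ext fun h => isEmptyElim h.1)⟩
    let b0 : TraceMap p U := ⟨1, fun h => isEmptyElim h.1, fun h => isEmptyElim h.1⟩
    rw [connWeight, Finset.sum_filter, Finset.sum_eq_single (c.disjUnion b0)]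
    · rw [if_pos, weight, Finset.sum_filter, Fintype.sum_subsingleton _ b0, if_pos le_rfl,
        kappa_of_isEmpty]
      refine ⟨?_, fun s _ => disjUnion_edge_inl _ _ _⟩
      rw [isConnected_iff _ (Sum.inl v)]
      rintro (w | w)
      · exact reachable_inl_iff.2 (hc.preconnected _ _)
      · exact isEmptyElim w
    · intro b _ hb
      refine if_neg fun h => hb ?_
      obtain ⟨b1, b2, rfl⟩ := exists_eq_disjUnion (hinv b h.2)
      have : b1 = c := by
        ext s : 2
        apply inlHalf_injective (W := U)
        rw [← disjUnion_edge_inl b1 b2, h.2 s trivial]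
      rw [this, Subsingleton.elim b2 b0]
    · simp
  · refine Finset.sum_eq_zero fun b hb => ?_
    simp only [Finset.mem_filter, Finset.mem_univ, true_and] at hb
    obtain ⟨hb1, hb2⟩ := hb
    exfalso
    apply hU
    rw [Finite.card_eq_zero_iff]
    refine ⟨fun u => ?_⟩
    obtain ⟨w, hw⟩ := (hinv b hb2).mem_of_reachable (hb1.preconnected (Sum.inl v) (Sum.inr u))
      ⟨v, rfl⟩
    simp at hw

end Distribution
end TensorFree

/-! ### Generating functions and the functional equation -/

namespace TensorFree
open TraceMap

theorem finsum_set_card (U : Type) [Finite U] (F : ℕ → ℕ → ℝ) :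
    ∑ᶠ D : Set U, F (Nat.card {u // u ∈ D}) (Nat.card {u // u ∉ D}) =
      ∑ k ∈ Finset.range (Nat.card U + 1), (Nat.card U).choose k * F k (Nat.card U - k) := by
  classical
  have : Fintype U := Fintype.ofFinite U
  rw [finsum_eq_sum_of_fintype, ← Fintype.finsetEquivSet.sum_comp]
  have : ∀ D : Finset U, F (Nat.card {u // u ∈ Fintype.finsetEquivSet D})
      (Nat.card {u // u ∉ Fintype.finsetEquivSet D}) = F D.card (Fintype.card U - D.card) := by
    intro D
    simp only [Fintype.finsetEquivSet_apply, Finset.mem_coe, Nat.card_eq_fintype_card]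
    rw [Fintype.card_coe, Fintype.card_subtype_compl, Fintype.card_coe]
  rw [Finset.sum_congr rfl fun D _ => this D, ← Finset.powerset_univ,
    Finset.sum_powerset_apply_card (fun k => F k (Fintype.card U - k)), Finset.card_univ,
    Nat.card_eq_fintype_card]
  simp only [nsmul_eq_mul]

namespace Distribution

open scoped Classical
open PowerSeries Nat

variable {p : ℕ} {V C U : Type} [Finite V] [Finite C] [Finite U]
variable (a : Distribution p Unit)

/-- The generating function of the sums of trace invariants over connected rooted maps. -/
noncomputable def momentSeries : PowerSeries ℝ :=
  PowerSeries.mk fun n => if n = 0 then 1 else p * n * a.connSum n / (n ! * (p : ℝ) ^ n)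

/-- The normalized sum of the free cumulants over connected rooted maps. -/
noncomputable def rootedCum (n : ℕ) : ℝ := p * n * a.connCum n / (n ! * (p : ℝ) ^ n)

/-- With the normalization `n ! * p ^ n`, which counts relabellings together with rotations at the
vertices, products of series correspond to splittings of the labels into two sets. -/
theorem coeff_mul_factorial (p : ℕ) (f g : PowerSeries ℝ) (n : ℕ) :
    n ! * (p : ℝ) ^ n * coeff n (f * g) = ∑ k ∈ Finset.range (n + 1), n.choose k *
      ((k ! * (p : ℝ) ^ k * coeff k f) * ((n - k)! * (p : ℝ) ^ (n - k) * coeff (n - k) g)) := by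
  rw [coeff_mul, Finset.Nat.sum_antidiagonal_eq_sum_range_succ_mk, Finset.mul_sum]
  refine Finset.sum_congr rfl fun k hk => ?_
  have hk : k ≤ n := Nat.lt_succ_iff.1 (Finset.mem_range.1 hk)
  have h1 : (n.choose k : ℝ) * k ! * (n - k)! = n ! := by
    exact_mod_cast Nat.choose_mul_factorial_mul_factorial hk
  have h2 : (p : ℝ) ^ k * (p : ℝ) ^ (n - k) = (p : ℝ) ^ n := by
    rw [← pow_add, Nat.add_sub_cancel' hk]
  rw [← h1, ← h2]; ring

theorem factorial_mul_coeff_momentSeries (hp0 : p ≠ 0) {n : ℕ} (hn : n ≠ 0) :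
    n ! * (p : ℝ) ^ n * coeff n a.momentSeries = (n * p : ℕ) * a.connSum n := by
  have h1 : (n ! : ℝ) ≠ 0 := by exact_mod_cast n.factorial_ne_zero
  have h2 : (p : ℝ) ^ n ≠ 0 := pow_ne_zero _ (by exact_mod_cast hp0)
  rw [momentSeries, coeff_mk, if_neg hn]
  push_cast
  field_simp

/-- Here `s` is the number of edges of `c` that are not prescribed. Prescribing one more by
`connWeight_step` splits off one factor `momentSeries`. -/
theorem connWeight_eq_coeff (hp : Even p) (hp0 : p ≠ 0) {c : TraceMap p C} (hc : c.IsConnected)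
    (s : ℕ) (S : Set (C × Fin p)) (hS : ∀ h ∈ S, c.edge h ∈ S) (hs : Sᶜ.ncard = 2 * s)
    (U : Type) [Finite U] : a.connWeight c S U =
      (Nat.card U)! * (p : ℝ) ^ Nat.card U * coeff (Nat.card U) (a.momentSeries ^ s) := by
  induction s generalizing S U with
  | zero =>
    rw [mul_zero, Set.ncard_eq_zero, Set.compl_empty_iff] at hs
    rw [hs, a.connWeight_univ hc, pow_zero, coeff_one]
    split_ifs with h
    · simp [h]
    · simp
  | succ s ih =>
    obtain ⟨x, hx⟩ : Sᶜ.Nonempty := by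
      rw [← Set.ncard_pos]; omega
    have hx' : c.edge x ∈ Sᶜ := fun h => hx (by simpa [c.edge_edge] using hS _ h)
    have hcompl : (insert x (insert (c.edge x) S))ᶜ = (Sᶜ \ {c.edge x}) \ {x} := by
      ext h; simp only [Set.mem_compl_iff, Set.mem_insert_iff, Set.mem_sdiff, Set.mem_singleton_iff]
      tauto
    have hcard : (insert x (insert (c.edge x) S))ᶜ.ncard = 2 * s := by
      have h1 := Set.ncard_sdiff_singleton_add_one hx'
      have h2 := Set.ncard_sdiff_singleton_add_one (s := Sᶜ \ {c.edge x}) (a := x)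
        ⟨hx, fun h => c.edge_ne x h.symm⟩
      rw [hcompl]
      omega
    have hF : ∀ h ∈ insert x (insert (c.edge x) S), c.edge h ∈ insert x (insert (c.edge x) S) := by
      rintro h (rfl | rfl | hh)
      · simp
      · simp [c.edge_edge]
      · exact Or.inr (Or.inr (hS _ hh))
    have ih' := fun (U : Type) [Finite U] => ih _ hF hcard U
    rw [a.connWeight_step hp hc hS hx]
    simp only [ih']
    rw [finsum_set_card U fun k l => (k ! * (p : ℝ) ^ k * coeff k (a.momentSeries ^ s)) *
      ((l * p : ℕ) * a.connSum l), pow_succ, coeff_mul_factorial, Finset.sum_range_succ,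
      Finset.sum_range_succ]
    -- The term `D = U` of the step vanishes because nothing is left to attach. In its place stands
    -- the case of the kept edge, which matches the constant coefficient 1 of `momentSeries`.
    simp only [Nat.sub_self, zero_mul, Nat.cast_zero, mul_zero, add_zero]
    rw [add_comm]
    congr 1
    · refine Finset.sum_congr rfl fun k hk => ?_
      have hk : k < Nat.card U := Finset.mem_range.1 hk
      rw [a.factorial_mul_coeff_momentSeries hp0 (n := Nat.card U - k) (by omega)]
    · simp [momentSeries]

/-- Decomposition of the connected maps on `V` above a given map according to the component of
that map which contains the vertex `v`. -/
theorem connSum_eq_finsum (hp : Even p) (v : V) : a.connSum (Nat.card V) =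
    ∑ᶠ D : Set V, if v ∈ D then
      ∑ c : TraceMap p {u // u ∈ D} with c.IsConnected,
        a.kappa c * a.connWeight c ∅ {u // u ∉ D} else 0 := by
  have : Fintype V := Fintype.ofFinite V
  have h1 : a.connSum (Nat.card V) = ∑ b' : TraceMap p V, a.kappa b' *
      (Finset.univ.filter fun b : TraceMap p V => b.IsConnected ∧ b' ≤ b).card := by
    rw [← sum_connected_value]
    simp only [← sum_kappa, Finset.sum_filter]
    have : ∀ b : TraceMap p V, (if b.IsConnected then
        ∑ b', if b' ≤ b then a.kappa b' else 0 else 0) =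
        ∑ b', if b.IsConnected ∧ b' ≤ b then a.kappa b' else 0 := by
      intro b
      by_cases h : b.IsConnected <;> simp [h]
    rw [Finset.sum_congr rfl fun b _ => this b, Finset.sum_comm]
    refine Finset.sum_congr rfl fun b' _ => ?_
    rw [← Finset.sum_filter, Finset.sum_const, nsmul_eq_mul, mul_comm]
  rw [h1, finsum_eq_sum_of_fintype]
  have h2 : ∀ b' : TraceMap p V, a.kappa b' *
      ((Finset.univ.filter fun b : TraceMap p V => b.IsConnected ∧ b' ≤ b).card : ℝ) =
      ∑ D : Set V, if D = {u | b'.graph.Reachable v u} then a.kappa b' *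
      ((Finset.univ.filter fun b : TraceMap p V => b.IsConnected ∧ b' ≤ b).card : ℝ) else 0 := by
    intro b'
    simp
  rw [Finset.sum_congr rfl fun b' _ => h2 b', Finset.sum_comm]
  refine Finset.sum_congr rfl fun D _ => ?_
  split_ifs with hv
  · have h3 : ∀ b' : TraceMap p V, (if D = {u | b'.graph.Reachable v u} then a.kappa b' *
        ((Finset.univ.filter fun b : TraceMap p V => b.IsConnected ∧ b' ≤ b).card : ℝ) else 0) =
        if b'.IsInvariant (Set.range (Equiv.sumCompl (· ∈ D) ∘ Sum.inl)) then
        if D = {u | b'.graph.Reachable v u} then a.kappa b' *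
        ((Finset.univ.filter fun b : TraceMap p V => b.IsConnected ∧ b' ≤ b).card : ℝ) else 0
        else 0 := by
      intro b'
      by_cases h : D = {u | b'.graph.Reachable v u}
      · rw [if_pos h, if_pos]
        have : Set.range (Equiv.sumCompl (· ∈ D) ∘ Sum.inl) = D := by
          ext u
          simp
        rw [this, h]
        exact b'.isInvariant_reachable v
      · simp [if_neg h]
    rw [Finset.sum_congr rfl fun b' _ => h3 b', ← Finset.sum_filter, sum_isInvariant,
      Finset.sum_filter]
    refine Finset.sum_congr rfl fun c _ => ?_
    set e := Equiv.sumCompl (· ∈ D) with he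
    -- Once `b'` splits along `D`, its component at `v` is all of `D` exactly when its part on `D`
    -- is connected.
    have h4 : ∀ b2 : TraceMap p {u // u ∉ D},
        D = {u | ((c.disjUnion b2).relabel e).graph.Reachable v u} ↔ c.IsConnected := by
      intro b2
      rw [isConnected_iff _ ⟨v, hv⟩]
      have hve : v = e (Sum.inl ⟨v, hv⟩) := rfl
      have hR : ∀ w, ((c.disjUnion b2).relabel e).graph.Reachable v (e w) ↔
          (c.disjUnion b2).graph.Reachable (Sum.inl ⟨v, hv⟩) w := fun w =>
        reachable_map_iff (v := Sum.inl ⟨v, hv⟩) (halfEdgeEquiv_fst e)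
      constructor
      · intro h w
        have hw : w.1 ∈ {u | ((c.disjUnion b2).relabel e).graph.Reachable v u} := h ▸ w.2
        exact reachable_inl_iff.1 ((hR (Sum.inl w)).1 hw)
      · intro h
        ext u
        obtain ⟨u, rfl⟩ := e.surjective u
        rw [Set.mem_ofPred_eq, hR]
        rcases u with u | u
        · simp [he, reachable_inl_iff, h]
        · simp [he, not_reachable_inl_inr, u.2]
    simp only [h4]
    by_cases hc : c.IsConnected
    · simp only [if_pos hc]
      rw [a.connWeight_eq, Finset.mul_sum]
      refine Finset.sum_congr rfl fun b2 _ => ?_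
      rw [a.kappa_relabel hp, a.kappa_disjUnion hp, mul_assoc]
      congr 3
      symm
      refine Finset.card_bij (fun b _ => b.relabel e) ?_ ?_ ?_
      · intro b hb
        simp only [Finset.mem_filter, Finset.mem_univ, true_and] at hb ⊢
        exact ⟨(isConnected_map_iff (halfEdgeEquiv_fst e)).2 hb.1,
          (map_le_map_iff hp (halfEdgeEquiv_fst e)).2 hb.2.1⟩
      · intro b _ b' _ h
        exact (mapEquiv (halfEdgeEquiv p e)).injective h
      · intro b hb
        obtain ⟨b, rfl⟩ := (mapEquiv (halfEdgeEquiv p e)).surjective b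
        simp only [Finset.mem_filter, Finset.mem_univ, true_and] at hb ⊢
        exact ⟨b, ⟨(isConnected_map_iff (halfEdgeEquiv_fst e)).1 hb.1,
          (map_le_map_iff hp (halfEdgeEquiv_fst e)).1 hb.2, by simp⟩, rfl⟩
    · simp [if_neg hc]
  · refine Finset.sum_eq_zero fun b' _ => if_neg ?_
    rintro rfl
    exact hv (SimpleGraph.Reachable.refl _)

/-- The functional equation between moments and free cumulants, in terms of coefficients. -/
theorem coeff_momentSeries (hp : Even p) (hp0 : p ≠ 0) {n : ℕ} (hn : n ≠ 0) :
    coeff n a.momentSeries = ∑ j ∈ Finset.range (n + 1),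
      a.rootedCum j * coeff (n - j) (a.momentSeries ^ (p / 2 * j)) := by
  have h1 : ∀ v : Fin n, a.connSum n = ∑ᶠ D : Set (Fin n), if v ∈ D then
      a.connCum (Nat.card {u // u ∈ D}) * ((Nat.card {u // u ∉ D})! *
        (p : ℝ) ^ Nat.card {u // u ∉ D} * coeff (Nat.card {u // u ∉ D})
          (a.momentSeries ^ (p / 2 * Nat.card {u // u ∈ D}))) else 0 := by
    intro v
    have := a.connSum_eq_finsum hp v
    rw [Nat.card_fin] at this
    rw [this]
    refine finsum_congr fun D => ?_
    congr 1
    rw [← a.sum_connected_kappa hp, Finset.sum_mul]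
    refine Finset.sum_congr rfl fun c hc => ?_
    simp only [Finset.mem_filter, Finset.mem_univ, true_and] at hc
    -- Nothing is prescribed initially, so the exponent is the number of all edges of `c`, half the
    -- number of its half-edges.
    rw [a.connWeight_eq_coeff hp hp0 hc (p / 2 * Nat.card {u // u ∈ D}) ∅ (by simp)]
    rw [Set.compl_empty, Set.ncard_univ, Nat.card_prod, Nat.card_fin, ← mul_assoc,
      Nat.two_mul_div_two_of_even hp, mul_comm]
  -- Summing over the chosen vertex `v` produces the factor `|D|`, which is the one needed to root
  -- the cumulant component.
  have h2 : (n : ℝ) * a.connSum n = ∑ᶠ D : Set (Fin n), (Nat.card {u // u ∈ D}) *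
      (a.connCum (Nat.card {u // u ∈ D}) * ((Nat.card {u // u ∉ D})! *
        (p : ℝ) ^ Nat.card {u // u ∉ D} * coeff (Nat.card {u // u ∉ D})
          (a.momentSeries ^ (p / 2 * Nat.card {u // u ∈ D})))) := by
    have : (n : ℝ) * a.connSum n = ∑ v : Fin n, a.connSum n := by simp
    rw [this, Finset.sum_congr rfl fun v _ => h1 v]
    simp only [finsum_eq_sum_of_fintype]
    rw [Finset.sum_comm]
    refine Finset.sum_congr rfl fun D _ => ?_
    rw [← Finset.sum_filter, Finset.sum_const, nsmul_eq_mul]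
    congr 2
    rw [Nat.card_eq_fintype_card, Fintype.card_subtype]
  rw [finsum_set_card (Fin n) fun j l => j * (a.connCum j * (l ! *
        (p : ℝ) ^ l * coeff l (a.momentSeries ^ (p / 2 * j)))), Nat.card_fin] at h2
  have hn1 : (n ! : ℝ) ≠ 0 := by exact_mod_cast n.factorial_ne_zero
  have hp1 : (p : ℝ) ≠ 0 := by exact_mod_cast hp0
  have hp2 : (p : ℝ) ^ n ≠ 0 := pow_ne_zero _ hp1
  rw [← mul_right_inj' (mul_ne_zero hn1 hp2), a.factorial_mul_coeff_momentSeries hp0 hn,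
    Finset.mul_sum]
  push_cast
  rw [mul_comm (n : ℝ), mul_assoc, h2, Finset.mul_sum]
  refine Finset.sum_congr rfl fun k hk => ?_
  have hk : k ≤ n := Nat.lt_succ_iff.1 (Finset.mem_range.1 hk)
  have h3 : (n.choose k : ℝ) * k ! * (n - k)! = n ! := by
    exact_mod_cast Nat.choose_mul_factorial_mul_factorial hk
  have h4 : (p : ℝ) ^ k * (p : ℝ) ^ (n - k) = (p : ℝ) ^ n := by
    rw [← pow_add, Nat.add_sub_cancel' hk]
  have hk1 : (k ! : ℝ) ≠ 0 := by exact_mod_cast k.factorial_ne_zero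
  have hk2 : (p : ℝ) ^ k ≠ 0 := pow_ne_zero _ hp1
  rw [rootedCum, ← h3, ← h4]
  field_simp

end Distribution
end TensorFree

namespace TensorFree
open TraceMap

/-! ### Labelled and unlabelled rooted maps -/

section RootedClass

variable {m n : ℕ} {V : Type}

/-- The bijection of half-edges that permutes the vertices and turns each of them. -/
def turn (g : Equiv.Perm V × (V → Fin (m + 1))) : Equiv.Perm (V × Fin (m + 1)) where
  toFun h := (g.1 h.1, h.2 + g.2 h.1)
  invFun h := (g.1.symm h.1, h.2 - g.2 (g.1.symm h.1))
  left_inv h := by simp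
  right_inv h := by simp

theorem turn_apply (g : Equiv.Perm V × (V → Fin (m + 1))) (h : V × Fin (m + 1)) :
    turn g h = (g.1 h.1, h.2 + g.2 h.1) := rfl

theorem rot_apply (h : V × Fin (m + 1)) : rot (m + 1) V h = (h.1, h.2 + 1) := by
  rw [rot, Equiv.prodCongr_apply, Prod.map_apply', finRotate_apply]
  rfl

theorem turn_rot (g : Equiv.Perm V × (V → Fin (m + 1))) (h : V × Fin (m + 1)) :
    turn g (rot (m + 1) V h) = rot (m + 1) V (turn g h) := by
  rw [rot_apply, rot_apply, turn_apply, turn_apply]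
  ext1
  · rfl
  · exact add_right_comm _ _ _

/-- A bijection commuting with the rotation is determined at each vertex by the image of one
half-edge. -/
theorem eq_turn {σ : Equiv.Perm V} {e : Equiv.Perm (V × Fin (m + 1))}
    (hv : ∀ h, (e h).1 = σ h.1) (hr : ∀ h, e (rot (m + 1) V h) = rot (m + 1) V (e h)) :
    e = turn (σ, fun v => (e (v, 0)).2) := by
  ext1 h
  obtain ⟨v, i⟩ := h
  rw [turn_apply]
  refine Prod.ext (hv _) ?_
  induction i using Fin.induction with
  | zero => simp
  | succ i ih =>
    have h1 : ((v, i.succ) : V × Fin (m + 1)) = rot (m + 1) V (v, i.castSucc) := by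
      rw [rot_apply, Fin.coeSucc_eq_succ]
    rw [h1, hr, rot_apply, rot_apply]
    simp only at ih ⊢
    rw [ih, add_right_comm]

/-- The action of vertex permutations and turns on rooted maps. -/
def RootedMap.turn (x : RootedMap (m + 1) n) (g : Equiv.Perm (Fin n) × (Fin n → Fin (m + 1))) :
    RootedMap (m + 1) n where
  map := x.map.map (TensorFree.turn g)
  connected := (isConnected_map_iff (σ := g.1) fun _ => rfl).2 x.connected
  root := TensorFree.turn g x.root

/-- Rigidity: the vertices on which two isomorphisms with the same target agree form an invariant
set. It contains the root vertex, hence every vertex by connectedness. -/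
theorem RootedMap.turn_injective (x : RootedMap (m + 1) n) : Function.Injective x.turn := by
  intro g g' h
  have h1 : x.map.map (TensorFree.turn g) = x.map.map (TensorFree.turn g') :=
    congrArg RootedMap.map h
  have h2 : TensorFree.turn g x.root = TensorFree.turn g' x.root := congrArg RootedMap.root h
  have key : ∀ y : Fin n × Fin (m + 1), TensorFree.turn g y = TensorFree.turn g' y ↔
      g.1 y.1 = g'.1 y.1 ∧ g.2 y.1 = g'.2 y.1 := by
    intro y
    rw [turn_apply, turn_apply, Prod.ext_iff]
    simp
  have hinv : x.map.IsInvariant {v | g.1 v = g'.1 v ∧ g.2 v = g'.2 v} := by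
    intro y hy
    have hy : TensorFree.turn g y = TensorFree.turn g' y := (key y).2 hy
    refine (key _).1 ?_
    rw [← map_edge, h1, hy, map_edge]
  have hall : ∀ v, g.1 v = g'.1 v ∧ g.2 v = g'.2 v := fun v =>
    hinv.mem_of_reachable (x.connected.preconnected x.root.1 v) ((key _).1 h2)
  ext1
  · ext1 v; exact (hall v).1
  · ext1 v; exact (hall v).2

theorem RootedMap.equiv_iff_exists_turn {x y : RootedMap (m + 1) n} :
    x ≈ y ↔ ∃ g, x.turn g = y := by
  constructor
  · rintro ⟨σ, e, h, hr⟩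
    refine ⟨(σ, fun v => (e (v, 0)).2), ?_⟩
    have he := eq_turn h.vertex h.rot
    obtain ⟨ym, yc, yr⟩ := y
    simp only [RootedMap.turn, RootedMap.mk.injEq]
    rw [← he]
    exact ⟨h.eq_map.symm, hr⟩
  · rintro ⟨g, rfl⟩
    exact ⟨g.1, TensorFree.turn g, isIso_map _ (fun _ => rfl) (turn_rot g), rfl⟩

-- A class is an orbit of a free action, so its size is the number of pairs of a vertex permutation
-- and a family of turns.
open Nat in
open scoped Classical in
theorem card_rootedClass_fiber (q : RootedClass (m + 1) n) [Fintype (RootedMap (m + 1) n)] :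
    (Finset.univ.filter fun x : RootedMap (m + 1) n =>
      (Quotient.mk _ x : RootedClass (m + 1) n) = q).card =
      n ! * (m + 1) ^ n := by
  obtain ⟨x, rfl⟩ := Quotient.exists_rep q
  have : (Finset.univ.filter fun y : RootedMap (m + 1) n =>
      (Quotient.mk _ y : RootedClass (m + 1) n) = Quotient.mk _ x) =
      Finset.univ.map ⟨x.turn, x.turn_injective⟩ := by
    ext y
    simp only [Finset.mem_filter, Finset.mem_univ, true_and, Finset.mem_map,
      Function.Embedding.coeFn_mk]
    rw [← RootedMap.equiv_iff_exists_turn]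
    exact Quotient.eq.trans ⟨Setoid.symm, Setoid.symm⟩
  have hcard := congrArg Finset.card this
  rw [Finset.card_map, Finset.card_univ, Fintype.card_prod, Fintype.card_perm,
    Fintype.card_fun, Fintype.card_fin, Fintype.card_fin] at hcard
  convert hcard

end RootedClass

namespace Distribution

open Nat PowerSeries
open scoped Classical

variable {p : ℕ} (a : Distribution p Unit)

/-- Labelled rooted maps are counted twice: by classes, each of size `n ! * p ^ n`, and by the `n *
p` choices of a root on each connected map. -/
theorem moment_eq_coeff (hp0 : p ≠ 0) (n : ℕ) : a.moment n = coeff n a.momentSeries := by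
  obtain ⟨m, rfl⟩ := Nat.exists_eq_succ_of_ne_zero hp0
  rw [moment, momentSeries, coeff_mk]
  split_ifs with hn
  · rfl
  have : Fintype (RootedMap (m + 1) n) := Fintype.ofFinite _
  have : Fintype (RootedClass (m + 1) n) := Fintype.ofFinite _
  have h1 : ∑ x : RootedMap (m + 1) n, a.value x.map =
      (n ! * (m + 1 : ℝ) ^ n) * ∑ q : RootedClass (m + 1) n, a.rootedVal n q := by
    rw [← Finset.sum_fiberwise (κ := RootedClass (m + 1) n) (s := Finset.univ)
      (g := fun x : RootedMap (m + 1) n => (Quotient.mk _ x : RootedClass (m + 1) n)),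
      Finset.mul_sum]
    refine Finset.sum_congr rfl fun q _ => ?_
    have h2 := card_rootedClass_fiber q
    have h3 : (n ! * (m + 1 : ℝ) ^ n) = ((n ! * (m + 1) ^ n : ℕ) : ℝ) := by push_cast; rfl
    rw [h3, ← h2, ← nsmul_eq_mul, ← Finset.sum_const]
    refine Finset.sum_congr rfl fun x hx => ?_
    rw [← (Finset.mem_filter.1 hx).2]
    rfl
  have h4 : ∑ x : RootedMap (m + 1) n, a.value x.map = (m + 1) * n * a.connSum n := by
    let e : RootedMap (m + 1) n ≃ {b : TraceMap (m + 1) (Fin n) // b.IsConnected} ×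
        (Fin n × Fin (m + 1)) :=
      { toFun := fun x => (⟨x.map, x.connected⟩, x.root)
        invFun := fun x => ⟨x.1.1, x.1.2, x.2⟩
        left_inv := fun _ => rfl
        right_inv := fun _ => rfl }
    have hval : ∀ x, a.value (e.symm x).map = a.value x.1.1 := fun _ => rfl
    rw [← e.symm.sum_comp, Finset.sum_congr rfl fun x _ => hval x, Fintype.sum_prod_type,
      Finset.sum_comm, connSum]
    simp only [Finset.sum_const, Finset.card_univ, Fintype.card_prod, Fintype.card_fin,
      nsmul_eq_mul]
    rw [← Finset.sum_subtype (p := fun b : TraceMap (m + 1) (Fin n) => b.IsConnected)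
      (Finset.univ.filter fun b : TraceMap (m + 1) (Fin n) => b.IsConnected)
      (fun b => by simp) a.value]
    push_cast
    ring
  have h5 : (n ! : ℝ) * (m + 1 : ℝ) ^ n ≠ 0 :=
    mul_ne_zero (by exact_mod_cast n.factorial_ne_zero) (pow_ne_zero _ (by positivity))
  rw [finsum_eq_sum_of_fintype, eq_div_iff (by push_cast; exact h5)]
  push_cast
  rw [← h4, h1, mul_comm]

end Distribution
end TensorFree

namespace TensorFree

/-! ### The functional equation for power series and the Fuss-Catalan case -/

section Series

open PowerSeries

/-- The relation between the moments and the free cumulants of a tensor of order `2 * q`, in terms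
of the generating function of the moments. -/
structure IsMomentSeries (q : ℕ) (κ : ℕ → ℝ) (M : PowerSeries ℝ) : Prop where
  cum_zero : κ 0 = 0
  coeff_zero : coeff 0 M = 1
  coeff_eq : ∀ n ≠ 0, coeff n M =
    ∑ j ∈ Finset.range (n + 1), κ j * coeff (n - j) (M ^ (q * j))

theorem coeff_pow_congr {M N : PowerSeries ℝ} {n : ℕ} (h : ∀ k ≤ n, coeff k M = coeff k N)
    (s : ℕ) : ∀ k ≤ n, coeff k (M ^ s) = coeff k (N ^ s) := by
  induction s with
  | zero => simp
  | succ s ih =>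
    intro k hk
    rw [pow_succ, pow_succ, coeff_mul, coeff_mul]
    refine Finset.sum_congr rfl fun x hx => ?_
    have := Finset.HasAntidiagonal.mem_antidiagonal.1 hx
    rw [ih x.1 (by omega), h x.2 (by omega)]

namespace IsMomentSeries

variable {q : ℕ} {κ κ' : ℕ → ℝ} {M N : PowerSeries ℝ}

theorem coeff_zero_pow (h : IsMomentSeries q κ M) (s : ℕ) : coeff 0 (M ^ s) = 1 := by
  have := h.coeff_zero
  rw [coeff_zero_eq_constantCoeff_apply] at *
  rw [map_pow, this, one_pow]

theorem coeff_eq_add (h : IsMomentSeries q κ M) {n : ℕ} (hn : n ≠ 0) : coeff n M =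
    ∑ j ∈ Finset.range n, κ j * coeff (n - j) (M ^ (q * j)) + κ n := by
  rw [h.coeff_eq n hn, Finset.sum_range_succ, Nat.sub_self, h.coeff_zero_pow, mul_one]

/-- The moments determine the free cumulants. -/
theorem cum_unique (h : IsMomentSeries q κ M) (h' : IsMomentSeries q κ' M) : κ = κ' := by
  funext n
  induction n using Nat.strong_induction_on with
  | _ n ih =>
  rcases eq_or_ne n 0 with rfl | hn
  · rw [h.cum_zero, h'.cum_zero]
  have h1 := h.coeff_eq_add hn
  rw [h'.coeff_eq_add hn, Finset.sum_congr rfl fun j hj => by rw [← ih j (Finset.mem_range.1 hj)]]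
    at h1
  linarith

/-- The free cumulants determine the moments. -/
theorem series_unique (h : IsMomentSeries q κ M) (h' : IsMomentSeries q κ N) : M = N := by
  ext n
  induction n using Nat.strong_induction_on with
  | _ n ih =>
  rcases eq_or_ne n 0 with rfl | hn
  · rw [h.coeff_zero, h'.coeff_zero]
  rw [h.coeff_eq n hn, h'.coeff_eq n hn]
  refine Finset.sum_congr rfl fun j _ => ?_
  -- Because `κ 0 = 0`, only coefficients of index less than `n` occur on the right-hand side.
  rcases eq_or_ne j 0 with rfl | hj
  · rw [h.cum_zero, zero_mul, zero_mul]
  · congr 1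
    exact coeff_pow_congr (n := n - j) (fun k hk => ih k (by omega)) _ _ le_rfl

/-- Dilation multiplies the free cumulant of order `n` by the `n`-th power of the factor. -/
theorem rescale (h : IsMomentSeries q κ M) (t : ℝ) :
    IsMomentSeries q (fun j => t ^ j * κ j) (PowerSeries.rescale t M) where
  cum_zero := by simp [h.cum_zero]
  coeff_zero := by simpa using h.coeff_zero
  coeff_eq n hn := by
    rw [coeff_rescale, h.coeff_eq n hn, Finset.mul_sum]
    refine Finset.sum_congr rfl fun j hj => ?_
    have hj : j ≤ n := Nat.lt_succ_iff.1 (Finset.mem_range.1 hj)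
    rw [← map_pow, coeff_rescale, ← Nat.add_sub_cancel' hj, pow_add, Nat.add_sub_cancel_left]
    ring

end IsMomentSeries

/-- The coefficients of the `r`-th power of the Fuss-Catalan series. -/
noncomputable def raney (p k r : ℕ) : ℝ := (r : ℝ) / (p * k + r : ℕ) * (p * k + r).choose k

theorem raney_zero_left (p : ℕ) {r : ℕ} (hr : r ≠ 0) : raney p 0 r = 1 := by
  have : (r : ℝ) ≠ 0 := by exact_mod_cast hr
  simp [raney, this]

/-- This is the coefficient form of `M ^ (r + 1) = M ^ r + X ^ 2 * M ^ (p + r)`, in the variable `X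
^ 2`. -/
theorem raney_succ {p : ℕ} (hp : p ≠ 0) (k r : ℕ) :
    raney p (k + 1) (r + 1) = raney p (k + 1) r + raney p k (p + r) := by
  obtain ⟨N, hN⟩ : ∃ N, N = p * (k + 1) + r := ⟨_, rfl⟩
  have hN1 : p * k + (p + r) = N := by rw [hN]; ring
  have hN0 : N ≠ 0 := by
    have : p * (k + 1) ≠ 0 := Nat.mul_ne_zero hp k.succ_ne_zero
    omega
  have hkN : k ≤ N := by
    rw [← hN1]
    exact le_trans (Nat.le_mul_of_pos_left k (Nat.pos_of_ne_zero hp)) (Nat.le_add_right _ _)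
  rw [raney, raney, raney, ← add_assoc, ← hN, hN1]
  have h1 : ((N + 1).choose (k + 1) : ℝ) * (k + 1) = (N + 1) * N.choose k := by
    exact_mod_cast (Nat.add_one_mul_choose_eq N k).symm
  have h2 : (N.choose (k + 1) : ℝ) * (k + 1) = N.choose k * (N - k) := by
    rw [← Nat.cast_sub hkN]
    exact_mod_cast Nat.choose_succ_right_eq N k
  have hk : (k + 1 : ℝ) ≠ 0 := by positivity
  have hNR : (N : ℝ) ≠ 0 := by exact_mod_cast hN0
  have hNR1 : (N + 1 : ℝ) ≠ 0 := by positivity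
  have hr : (N : ℝ) = p * (k + 1) + r := by exact_mod_cast hN
  rw [← eq_div_iff hk] at h1 h2
  rw [h1, h2]
  push_cast
  field_simp
  linear_combination (N.choose k : ℝ) * hr

/-- The single cumulant turns the functional equation into `M = 1 + X ^ 2 * M ^ p`. All powers of
`M` are treated together because the resulting recursion mixes exponents. -/
theorem IsMomentSeries.coeff_pow {p : ℕ} (hp : Even p) (hp0 : p ≠ 0) {M : PowerSeries ℝ}
    (h : IsMomentSeries (p / 2) (fun j => if j = 2 then 1 else 0) M) (k r : ℕ) (hr : r ≠ 0) :
    coeff (2 * k) (M ^ r) = raney p k r ∧ coeff (2 * k + 1) (M ^ r) = 0 := by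
  have hp2 : p / 2 * 2 = p := by rw [mul_comm]; exact Nat.two_mul_div_two_of_even hp
  have hcoeff : ∀ n, coeff n M = coeff n (1 + X ^ 2 * M ^ p) := by
    intro n
    rcases eq_or_ne n 0 with rfl | hn
    · rw [h.coeff_zero]; simp
    rw [h.coeff_eq n hn, map_add, coeff_one, if_neg hn, zero_add, coeff_X_pow_mul']
    split_ifs with h2
    · rw [Finset.sum_eq_single 2]
      · simp [hp2]
      · intro j _ hj; simp [hj]
      · intro hj; simp at hj; omega
    · refine Finset.sum_eq_zero fun j hj => ?_
      rw [if_neg, zero_mul]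
      rintro rfl
      simp at hj; omega
  have hM : M = 1 + X ^ 2 * M ^ p := by ext n; exact hcoeff n
  have hpow : ∀ r, M ^ (r + 1) = M ^ r + X ^ 2 * M ^ (p + r) := by
    intro r
    calc M ^ (r + 1) = M ^ r * M := pow_succ _ _
      _ = M ^ r * (1 + X ^ 2 * M ^ p) := by rw [← hM]
      _ = _ := by ring
  induction k generalizing r with
  | zero =>
    refine ⟨by rw [mul_zero, h.coeff_zero_pow, raney_zero_left p hr], ?_⟩
    clear hr
    induction r with
    | zero => simp [coeff_one]
    | succ r ih => rw [hpow, map_add, ih, coeff_X_pow_mul']; simp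
  | succ k ih =>
    -- For positive index both sides vanish at `r = 0`, so the inner induction starts there. At
    -- index 0 this fails: `raney p 0 0` is 0 by the convention for division, whereas `M ^ 0` has
    -- constant coefficient 1.
    clear hr
    have hk : coeff (2 * (k + 1)) (M ^ r) = raney p (k + 1) r ∧
        coeff (2 * (k + 1) + 1) (M ^ r) = 0 := by
      induction r with
      | zero => simp [coeff_one, raney]
      | succ r ihr =>
        obtain ⟨h1, h2⟩ := ih (p + r) (by omega)
        rw [hpow, map_add, map_add, ihr.1, ihr.2, coeff_X_pow_mul', coeff_X_pow_mul',
          if_pos (by omega), if_pos (by omega), raney_succ hp0, ← h1, zero_add, ← h2]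
        exact ⟨rfl, rfl⟩
    exact hk

/-- The moments of the semicircular law. -/
noncomputable def semicircularMoment (p n : ℕ) : ℝ := if Even n then fussCatalan p (n / 2) else 0

theorem IsMomentSeries.coeff_eq_semicircularMoment {p : ℕ} (hp : Even p) (hp0 : p ≠ 0)
    {M : PowerSeries ℝ} (h : IsMomentSeries (p / 2) (fun j => if j = 2 then 1 else 0) M) (n : ℕ) :
    coeff n M = semicircularMoment p n := by
  rw [semicircularMoment]
  rcases Nat.even_or_odd' n with ⟨k, rfl | rfl⟩
  · rw [if_pos (by simp), Nat.mul_div_cancel_left k two_pos]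
    have := (h.coeff_pow hp hp0 k 1 one_ne_zero).1
    rw [pow_one] at this
    rw [this, raney, fussCatalan]
    push_cast
    ring
  · rw [if_neg (by simp)]
    have := (h.coeff_pow hp hp0 k 1 one_ne_zero).2
    rwa [pow_one] at this

end Series

theorem Distribution.isMomentSeries {p : ℕ} (hp : Even p) (hp0 : p ≠ 0) (a : Distribution p Unit) :
    IsMomentSeries (p / 2) a.rootedCum a.momentSeries where
  cum_zero := by simp [Distribution.rootedCum]
  coeff_zero := by simp [Distribution.momentSeries]
  coeff_eq _ hn := a.coeff_momentSeries hp hp0 hn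

end TensorFree

namespace TensorFree
open TraceMap

open scoped Classical

/-! ### Free semicircular elements: existence and sums -/

section PairCumulant

variable {p : ℕ} {V W ι : Type}

/-- The free cumulants of a free family of semicircular elements, up to normalization: they are
carried by the maps whose components have two vertices, with the same decoration. -/
noncomputable def pairCumulant (t : ℝ) (b : TraceMap p V) (c : V → ι) : ℝ :=
  if ∀ v, {w | b.graph.Reachable v w}.ncard = 2 ∧ ∀ w, b.graph.Reachable v w → c w = c v then
    t ^ Nat.card V else 0

theorem pairCumulant_map (t : ℝ) {σ : V ≃ W} {e : V × Fin p ≃ W × Fin p}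
    (hv : ∀ h, (e h).1 = σ h.1) (b : TraceMap p V) (c : W → ι) :
    pairCumulant t (b.map e) c = pairCumulant t b (c ∘ σ) := by
  have h1 : ∀ v, {w | (b.map e).graph.Reachable (σ v) w} = σ '' {w | b.graph.Reachable v w} := by
    intro v
    ext w
    obtain ⟨w, rfl⟩ := σ.surjective w
    simp [reachable_map_iff hv]
  have h2 : (∀ v, {w | (b.map e).graph.Reachable v w}.ncard = 2 ∧
      ∀ w, (b.map e).graph.Reachable v w → c w = c v) ↔
      ∀ v, {w | b.graph.Reachable v w}.ncard = 2 ∧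
        ∀ w, b.graph.Reachable v w → (c ∘ σ) w = (c ∘ σ) v := by
    rw [← σ.forall_congr_right]
    refine forall_congr' fun v => ?_
    rw [h1, Set.ncard_image_of_injective _ σ.injective, ← σ.forall_congr_right]
    simp only [reachable_map_iff hv, Function.comp_apply]
  rw [pairCumulant, pairCumulant, Nat.card_congr σ]
  exact if_congr h2 rfl rfl

theorem pairCumulant_disjUnion [Finite V] [Finite W] (t : ℝ) (b : TraceMap p V)
    (b' : TraceMap p W) (c : V → ι) (c' : W → ι) :
    pairCumulant t (b.disjUnion b') (Sum.elim c c') =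
      pairCumulant t b c * pairCumulant t b' c' := by
  have hl : ∀ v, {w | (b.disjUnion b').graph.Reachable (Sum.inl v) w} =
      Sum.inl '' {w | b.graph.Reachable v w} := by
    intro v
    ext (w | w)
    · simp [reachable_inl_iff]
    · simp [not_reachable_inl_inr]
  have hr : ∀ v, {w | (b.disjUnion b').graph.Reachable (Sum.inr v) w} =
      Sum.inr '' {w | b'.graph.Reachable v w} := by
    intro v
    ext (w | w)
    · simpa using fun h => not_reachable_inl_inr (SimpleGraph.Reachable.symm h)
    · simp [reachable_inr_iff]
  have hlr : ∀ v w, ¬ (b.disjUnion b').graph.Reachable (Sum.inr v) (Sum.inl w) :=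
    fun v w h => not_reachable_inl_inr h.symm
  rw [pairCumulant, pairCumulant, pairCumulant, ite_mul, zero_mul, mul_ite, mul_zero, ← ite_and,
    Nat.card_sum, pow_add]
  refine if_congr ?_ rfl rfl
  rw [Sum.forall]
  simp only [hl, hr, Set.ncard_image_of_injective _ Sum.inl_injective,
    Set.ncard_image_of_injective _ Sum.inr_injective, Sum.forall, reachable_inl_iff,
    reachable_inr_iff, not_reachable_inl_inr, hlr, Sum.elim_inl, Sum.elim_inr]
  simp

/-- The joint distribution of a free family of semicircular elements. -/
noncomputable def pairDistribution (hp : Even p) (ι : Type) (t : ℝ) : Distribution p ι where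
  val b c := ∑ b' with b' ≤ b, pairCumulant t b' c
  val_iso b b' σ e c h := by
    rw [h.eq_map, sum_le_map hp h.vertex]
    exact Finset.sum_congr rfl fun b _ => (pairCumulant_map t h.vertex b c).symm
  val_disjUnion b b' c c' := by
    rw [sum_le_disjUnion hp, Finset.sum_mul_sum]
    exact Finset.sum_congr rfl fun b _ => Finset.sum_congr rfl fun b' _ =>
      pairCumulant_disjUnion t b b' c c'
  val_empty {V} _ _ b c := by
    have : Subsingleton (TraceMap p V) :=
      ⟨fun a b => TraceMap.ext (Equiv.ext fun h => isEmptyElim h.1)⟩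
    rw [Finset.sum_filter, Fintype.sum_subsingleton _ b]
    simp [pairCumulant]

theorem cumulant_pairDistribution [Finite V] (hp : Even p) (t : ℝ) (c : V → ι) :
    (pairDistribution hp ι t).cumulant c = fun b : TraceMap p V => pairCumulant t b c :=
  (eq_freeCumulant_of_sum _ (fun b => pairCumulant t b c) fun _ => rfl).symm

/-- A connected map with two different decorations violates the condition of equal decoration in
`pairCumulant`. -/
theorem isFree_pairDistribution (hp : Even p) (t : ℝ) : (pairDistribution hp ι t).IsFree := by
  rintro V _ b c hb ⟨v, w, hvw⟩
  refine (congrFun (cumulant_pairDistribution hp t c) b).trans (if_neg fun h => hvw ?_)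
  exact (h w).2 v (hb.preconnected _ _)

theorem pairCumulant_of_isConnected (t : ℝ) {n : ℕ} {b : TraceMap p (Fin n)} (hb : b.IsConnected)
    (i : ι) : pairCumulant t b (fun _ => i) = if n = 2 then t ^ 2 else 0 := by
  have h1 : ∀ v, {w | b.graph.Reachable v w} = Set.univ := fun v => by
    ext w; simpa using hb.preconnected v w
  obtain ⟨v⟩ := hb.nonempty
  rw [pairCumulant]
  simp only [h1, Set.ncard_univ, Nat.card_fin, implies_true, and_true]
  have : (∀ _ : Fin n, n = 2) ↔ n = 2 := ⟨fun h => h v, fun h _ => h⟩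
  simp only [this]
  split_ifs with h
  · rw [h]
  · rfl

theorem exists_isConnected_two (hp0 : p ≠ 0) : ∃ b : TraceMap p (Fin 2), b.IsConnected := by
  refine ⟨⟨(Equiv.swap 0 1).prodCongr (Equiv.refl _), ?_, ?_⟩, ?_⟩
  · rintro ⟨v, i⟩; simp
  · rintro ⟨v, i⟩ h
    have := congrArg Prod.fst h
    fin_cases v <;> simp at this
  · rw [isConnected_iff _ 0]
    intro w
    fin_cases w
    · exact SimpleGraph.Reachable.refl _
    · exact reachable_edge _ ((0 : Fin 2), (⟨0, Nat.pos_of_ne_zero hp0⟩ : Fin p))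

/-- There are free families of elements whose only free cumulant is the second one. -/
theorem exists_isFree (hp : Even p) (hp0 : p ≠ 0) (ι : Type) : ∃ φ : Distribution p ι,
    φ.IsFree ∧ ∀ i, (φ.marginal i).rootedCum = fun j => if j = 2 then 1 else 0 := by
  set N := (Finset.univ.filter fun b : TraceMap p (Fin 2) => b.IsConnected).card with hN
  have hN0 : (N : ℝ) ≠ 0 := by
    obtain ⟨b, hb⟩ := exists_isConnected_two hp0
    have : 0 < N := Finset.card_pos.2 ⟨b, by simpa using hb⟩
    exact_mod_cast this.ne'
  have hpR : (p : ℝ) ≠ 0 := by exact_mod_cast hp0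
  -- Each of the `N` connected maps on two labelled vertices has cumulant `t ^ 2`, which makes the
  -- rooted cumulant of order 2 equal to `N * t ^ 2 / p`; this is 1 for `t = √(p / N)`.
  refine ⟨pairDistribution hp ι √(p / N), isFree_pairDistribution hp _, fun i => ?_⟩
  funext n
  have hk : ∀ b : TraceMap p (Fin n), ((pairDistribution hp ι √(p / N)).marginal i).kappa b =
      pairCumulant √(p / N) b (fun _ => i) :=
    fun b => congrFun (cumulant_pairDistribution hp _ fun _ => i) b
  rw [Distribution.rootedCum, Distribution.connCum, Finset.sum_congr rfl fun b hb => by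
    rw [hk b, pairCumulant_of_isConnected _ (Finset.mem_filter.1 hb).2]]
  split_ifs with hn
  · subst hn
    rw [Finset.sum_const, ← hN, Real.sq_sqrt (by positivity), nsmul_eq_mul]
    simp only [Nat.factorial_two]
    push_cast
    field_simp
  · simp

end PairCumulant

namespace Distribution

open PowerSeries

variable {p : ℕ}

/-- Free cumulants of free elements are additive. -/
theorem IsFree.rootedCum_sum {φ : Distribution p (Fin 2)} (hφ : φ.IsFree) (n : ℕ) :
    φ.sum.rootedCum n = (φ.marginal 0).rootedCum n + (φ.marginal 1).rootedCum n := by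
  have key : ∀ b : TraceMap p (Fin n), b.IsConnected →
      φ.sum.kappa b = (φ.marginal 0).kappa b + (φ.marginal 1).kappa b := by
    intro b hb
    obtain ⟨v⟩ := hb.nonempty
    have h1 : φ.sum.kappa b = ∑ᶠ c : Fin n → Fin 2, φ.cumulant c b := φ.cumulant_sum b
    have hne : (fun _ => 0 : Fin n → Fin 2) ≠ fun _ => 1 := fun h => by simpa using congrFun h v
    rw [h1, finsum_eq_sum_of_fintype, ← Finset.sum_subset (Finset.subset_univ
      {(fun _ => 0 : Fin n → Fin 2), fun _ => 1}), Finset.sum_pair hne]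
    · rfl
    · intro c _ hc
      refine hφ _ b c hb ?_
      by_contra! H
      apply hc
      simp only [Finset.mem_insert, Finset.mem_singleton]
      have hcv : c = fun _ => c v := funext fun w => H w v
      rw [hcv]
      generalize c v = i
      fin_cases i
      · exact Or.inl rfl
      · exact Or.inr rfl
  rw [rootedCum, rootedCum, rootedCum, connCum, connCum, connCum,
    Finset.sum_congr rfl fun b hb => key b (Finset.mem_filter.1 hb).2, Finset.sum_add_distrib]
  ring

theorem moment_of_rootedCum (hp : Even p) (hp0 : p ≠ 0) {a : Distribution p Unit}
    (ha : a.rootedCum = fun j => if j = 2 then 1 else 0) (n : ℕ) :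
    a.moment n = semicircularMoment p n := by
  have := a.isMomentSeries hp hp0
  rw [ha] at this
  rw [a.moment_eq_coeff hp0, this.coeff_eq_semicircularMoment hp hp0]

/-- The model provided by `exists_isFree` has the same moments and known cumulants, and moments
determine cumulants. -/
theorem rootedCum_of_moment (hp : Even p) (hp0 : p ≠ 0) {a : Distribution p Unit}
    (ha : ∀ n, a.moment n = semicircularMoment p n) :
    a.rootedCum = fun j => if j = 2 then 1 else 0 := by
  obtain ⟨φ, -, hφ⟩ := exists_isFree hp hp0 Unit
  have h1 := (φ.marginal ()).isMomentSeries hp hp0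
  have h2 := a.isMomentSeries hp hp0
  have h3 : (φ.marginal ()).momentSeries = a.momentSeries := by
    ext n
    rw [← moment_eq_coeff _ hp0, ← moment_eq_coeff _ hp0, ha, moment_of_rootedCum hp hp0 (hφ ())]
  rw [hφ, h3] at h1
  exact h2.cum_unique h1

/-- The sum of two free semicircular elements is a dilated semicircular element. -/
theorem IsFree.moment_sum (hp : Even p) (hp0 : p ≠ 0) {φ : Distribution p (Fin 2)}
    (hφ : φ.IsFree) (h : ∀ i n, (φ.marginal i).moment n = semicircularMoment p n) (n : ℕ) :
    φ.sum.moment n = √2 ^ n * semicircularMoment p n := by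
  have h0 := rootedCum_of_moment hp hp0 (h 0)
  have h1 := rootedCum_of_moment hp hp0 (h 1)
  have h2 := ((φ.marginal 0).isMomentSeries hp hp0).rescale √2
  have h3 := φ.sum.isMomentSeries hp hp0
  -- Only order 2 matters, where the sum `1 + 1` equals `√2 ^ 2`.
  have h4 : φ.sum.rootedCum = fun j => √2 ^ j * (φ.marginal 0).rootedCum j := by
    funext j
    rw [hφ.rootedCum_sum, h0, h1]
    by_cases hj : j = 2
    · simp only [hj, if_true]
      rw [Real.sq_sqrt (by norm_num)]
      norm_num
    · simp [hj]
  rw [h4] at h3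
  rw [moment_eq_coeff _ hp0, h3.series_unique h2, coeff_rescale, ← moment_eq_coeff _ hp0, h]

end Distribution
end TensorFree

namespace TensorFree

/-! ### Compactly supported measures and their moments -/

section CompactProb

theorem isCompactProb_iff {μ : Measure ℝ} :
    IsCompactProb μ ↔ IsProbabilityMeasure μ ∧ ∃ M : ℝ, ∀ᵐ x ∂μ, |x| ≤ M := by
  refine and_congr_right fun h => exists_congr fun M => ?_
  rw [← mem_ae_iff_prob_eq_one measurableSet_Icc]
  exact Filter.eventually_congr (Filter.Eventually.of_forall fun x => by rw [abs_le])

theorem IsCompactProb.integrable_of_continuous {μ : Measure ℝ} (h : IsCompactProb μ) {f : ℝ → ℝ}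
    (hf : Continuous f) : Integrable f μ := by
  obtain ⟨_, M, hM⟩ := isCompactProb_iff.1 h
  obtain ⟨C, hC⟩ := isCompact_Icc.exists_bound_of_continuousOn (s := Set.Icc (-M) M)
    hf.continuousOn
  refine Integrable.of_bound hf.aestronglyMeasurable C ?_
  filter_upwards [hM] with x hx
  exact hC x (abs_le.1 hx)

theorem integral_eval_eq {μ ν : Measure ℝ} (hμ : IsCompactProb μ) (hν : IsCompactProb ν)
    (h : ∀ n : ℕ, ∫ x, x ^ n ∂μ = ∫ x, x ^ n ∂ν) (q : Polynomial ℝ) :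
    ∫ x, q.eval x ∂μ = ∫ x, q.eval x ∂ν := by
  simp only [Polynomial.eval_eq_sum_range]
  rw [integral_finsetSum, integral_finsetSum]
  · simp only [integral_const_mul, h]
  · exact fun i _ => hν.integrable_of_continuous (by fun_prop)
  · exact fun i _ => hμ.integrable_of_continuous (by fun_prop)

/-- A compactly supported probability measure is determined by its moments. -/
theorem IsCompactProb.ext_of_moments {μ ν : Measure ℝ} (hμ : IsCompactProb μ)
    (hν : IsCompactProb ν) (h : ∀ n : ℕ, ∫ x, x ^ n ∂μ = ∫ x, x ^ n ∂ν) : μ = ν := by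
  have hμp := hμ.1
  have hνp := hν.1
  obtain ⟨-, M, hM⟩ := isCompactProb_iff.1 hμ
  obtain ⟨-, N, hN⟩ := isCompactProb_iff.1 hν
  refine ext_of_forall_integral_eq_of_IsFiniteMeasure fun f => ?_
  refine eq_of_forall_dist_le fun ε hε => ?_
  -- Weierstrass approximation on one interval that carries both measures.
  obtain ⟨q, hq⟩ := exists_polynomial_near_of_continuousOn (-max M N) (max M N) f
    f.continuous.continuousOn (ε / 2) (by positivity)
  have key : ∀ ρ : Measure ℝ, IsCompactProb ρ → (∀ᵐ x ∂ρ, |x| ≤ max M N) →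
      |∫ x, q.eval x ∂ρ - ∫ x, f x ∂ρ| ≤ ε / 2 := by
    intro ρ hρ hb
    have := hρ.1
    rw [← integral_sub (hρ.integrable_of_continuous (Polynomial.continuous q))
      (hρ.integrable_of_continuous f.continuous), ← Real.norm_eq_abs]
    have := norm_integral_le_of_norm_le_const (μ := ρ) (f := fun x => q.eval x - f x)
      (C := ε / 2) ?_
    · simpa using this
    · filter_upwards [hb] with x hx
      exact (hq x (abs_le.1 hx)).le
  have h1 := key μ hμ (hM.mono fun x hx => hx.trans (le_max_left _ _))
  have h2 := key ν hν (hN.mono fun x hx => hx.trans (le_max_right _ _))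
  rw [integral_eval_eq hμ hν h q, abs_le] at h1
  rw [abs_le] at h2
  rw [Real.dist_eq, abs_le]
  constructor <;> linarith [h1.1, h1.2, h2.1, h2.2]

theorem IsCompactProb.map_mul {μ : Measure ℝ} (hμ : IsCompactProb μ) (t : ℝ) :
    IsCompactProb (μ.map fun x => t * x) := by
  obtain ⟨h, M, hM⟩ := isCompactProb_iff.1 hμ
  refine isCompactProb_iff.2 ⟨Measure.isProbabilityMeasure_map (by fun_prop), |t| * M, ?_⟩
  rw [ae_map_iff (by fun_prop) (measurableSet_le (by fun_prop) (by fun_prop))]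
  filter_upwards [hM] with x hx
  rw [abs_mul]
  gcongr

theorem integral_pow_map_mul (μ : Measure ℝ) (t : ℝ) (n : ℕ) :
    ∫ x, x ^ n ∂(μ.map fun x => t * x) = t ^ n * ∫ x, x ^ n ∂μ := by
  rw [integral_map (by fun_prop) (by fun_prop), ← integral_const_mul]
  simp only [mul_pow]

end CompactProb

/-! ### Fuss-Catalan numbers as moments of a measure -/

section Stieltjes

/-- The sequence `m` is the moment sequence of a probability measure on a bounded interval of
non-negative numbers. -/
def IsPosMomentSeq (m : ℕ → ℝ) : Prop :=
  ∃ (μ : Measure ℝ) (M : ℝ), IsProbabilityMeasure μ ∧ (∀ᵐ x ∂μ, 0 ≤ x ∧ x ≤ M) ∧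
    ∀ n : ℕ, ∫ x, x ^ n ∂μ = m n

theorem isPosMomentSeq_pow {c : ℝ} (hc : 0 ≤ c) : IsPosMomentSeq fun n => c ^ n :=
  ⟨Measure.dirac c, c, inferInstance, by
    rw [ae_dirac_iff (measurableSet_Icc (a := (0 : ℝ)) (b := c))]
    exact ⟨hc, le_rfl⟩, fun n => by simp⟩

/-- Moments of a product of independent random variables multiply. -/
theorem IsPosMomentSeq.mul {m m' : ℕ → ℝ} (h : IsPosMomentSeq m) (h' : IsPosMomentSeq m') :
    IsPosMomentSeq fun n => m n * m' n := by
  obtain ⟨μ, M, hμ, hM, hm⟩ := h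
  obtain ⟨ν, N, hν, hN, hn⟩ := h'
  refine ⟨(μ.prod ν).map fun x => x.1 * x.2, M * N, Measure.isProbabilityMeasure_map
    (by fun_prop), ?_, fun n => ?_⟩
  · rw [ae_map_iff (by fun_prop) (measurableSet_Icc (a := (0 : ℝ)) (b := M * N))]
    have h1 : ∀ᵐ x ∂(μ.prod ν), 0 ≤ x.1 ∧ x.1 ≤ M := Measure.quasiMeasurePreserving_fst.ae hM
    have h2 : ∀ᵐ x ∂(μ.prod ν), 0 ≤ x.2 ∧ x.2 ≤ N := Measure.quasiMeasurePreserving_snd.ae hN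
    filter_upwards [h1, h2] with x hx hy
    exact ⟨mul_nonneg hx.1 hy.1, mul_le_mul hx.2 hy.2 hy.1 (hx.1.trans hx.2)⟩
  · beta_reduce
    rw [integral_map (by fun_prop) (by fun_prop), ← hm, ← hn, ← integral_prod_mul]
    simp only [mul_pow]

theorem IsPosMomentSeq.prod {ι : Type} (s : Finset ι) (m : ι → ℕ → ℝ)
    (h : ∀ i ∈ s, IsPosMomentSeq (m i)) : IsPosMomentSeq fun n => ∏ i ∈ s, m i n := by
  classical
  induction s using Finset.induction_on with
  | empty => simpa using isPosMomentSeq_pow zero_le_one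
  | insert i s hi ih =>
    simp only [Finset.prod_insert hi]
    exact (h i (Finset.mem_insert_self i s)).mul
      (ih fun j hj => h j (Finset.mem_insert_of_mem hj))

open ProbabilityTheory

theorem betaPDFReal_nonneg {a c : ℝ} (ha : 0 < a) (hc : 0 < c) (x : ℝ) :
    0 ≤ betaPDFReal a c x := by
  by_cases hx : 0 < x ∧ x < 1
  · exact (betaPDFReal_pos hx.1 hx.2 ha hc).le
  · rw [betaPDFReal, if_neg hx]

theorem integral_betaPDFReal {a c : ℝ} (ha : 0 < a) (hc : 0 < c) :
    ∫ x, betaPDFReal a c x = 1 := by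
  rw [integral_eq_lintegral_of_nonneg_ae
    (Filter.Eventually.of_forall (betaPDFReal_nonneg ha hc)) (by fun_prop)]
  have := lintegral_betaPDF_eq_one ha hc
  simp only [betaPDF] at this
  rw [this, ENNReal.toReal_one]

theorem measurable_betaPDF (a c : ℝ) : Measurable (betaPDF a c) :=
  (measurable_betaPDFReal a c).ennreal_ofReal

/-- Multiplication by `x ^ n` turns the density with parameter `a` into the one with parameter `a +
n`, up to the ratio of the normalizing constants. -/
theorem integral_pow_betaMeasure {a c : ℝ} (ha : 0 < a) (hc : 0 < c) (n : ℕ) :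
    ∫ x, x ^ n ∂(betaMeasure a c) = beta (a + n) c / beta a c := by
  have han : 0 < a + n := by positivity
  have hpdf : ∀ x, (betaPDF a c x).toReal • x ^ n =
      beta (a + n) c / beta a c * betaPDFReal (a + n) c x := by
    intro x
    rw [betaPDF, ENNReal.toReal_ofReal (betaPDFReal_nonneg ha hc x), betaPDFReal, betaPDFReal]
    split_ifs with hx
    · have h1 := (beta_pos ha hc).ne'
      have h2 := (beta_pos han hc).ne'
      rw [show a + n - 1 = (a - 1) + n by ring, Real.rpow_add hx.1, Real.rpow_natCast]
      simp only [smul_eq_mul]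
      field_simp
    · simp
  rw [betaMeasure, integral_withDensity_eq_integral_toReal_smul
    (measurable_betaPDF a c)
    (Filter.Eventually.of_forall fun x => ENNReal.ofReal_lt_top)]
  simp only [hpdf, integral_const_mul, integral_betaPDFReal han hc, mul_one]

theorem beta_add_natCast {a c : ℝ} (ha : 0 < a) (hc : 0 < c) (n : ℕ) :
    beta (a + n) c / beta a c = ∏ i ∈ Finset.range n, (a + i) / (a + c + i) := by
  induction n with
  | zero => simpa using div_self (beta_pos ha hc).ne'
  | succ n ih =>
    have h1 : a + n ≠ 0 := by positivity
    have h2 : a + c + n ≠ 0 := by positivity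
    have h3 := (Real.Gamma_pos_of_pos (s := a + c + n) (by positivity)).ne'
    rw [Finset.prod_range_succ, ← ih, beta, beta, beta]
    push_cast
    rw [show a + (n + 1 : ℝ) = (a + n) + 1 by ring, Real.Gamma_add_one h1,
      show a + n + 1 + c = (a + c + n) + 1 by ring, Real.Gamma_add_one h2,
      show a + n + c = a + c + n by ring]
    field_simp

/-- These ratios of rising factorials are the moments of the beta law with parameters `a` and `b -
a`. -/
theorem isPosMomentSeq_beta {a b : ℝ} (ha : 0 < a) (hab : a < b) :
    IsPosMomentSeq fun n => ∏ i ∈ Finset.range n, (a + i) / (b + i) := by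
  have hc : 0 < b - a := sub_pos.2 hab
  refine ⟨betaMeasure a (b - a), 1, isProbabilityMeasureBeta ha hc, ?_, fun n => ?_⟩
  · rw [betaMeasure, ae_withDensity_iff (measurable_betaPDF _ _)]
    refine Filter.Eventually.of_forall fun x hx => ?_
    constructor <;> by_contra! H
    · exact hx (betaPDF_eq_zero_of_nonpos H.le)
    · exact hx (betaPDF_eq_zero_of_one_le H.le)
  · rw [integral_pow_betaMeasure ha hc, beta_add_natCast ha hc, add_sub_cancel]

open Nat in
theorem fussCatalan_eq_factorial (r k : ℕ) :
    fussCatalan (r + 1) k = ((r + 1) * k)! / (k ! * (r * k + 1)!) := by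
  have h1 : (r + 1) * k + 1 = k + (r * k + 1) := by ring
  have h2 : (((r + 1) * k + 1)! : ℝ) = ((r + 1) * k + 1) * ((r + 1) * k)! := by
    rw [Nat.factorial_succ]; push_cast; ring
  rw [fussCatalan, h1, Nat.cast_add_choose ℝ, ← h1, h2]
  push_cast
  field_simp

open Nat in
theorem fussCatalan_succ (r k : ℕ) : fussCatalan (r + 1) (k + 1) = fussCatalan (r + 1) k *
    ((r + 1) * ∏ j ∈ Finset.range r, ((r + 1) * k + j + 1 : ℝ) / (r * k + j + 2)) := by
  have h1 : (((r + 1) * (k + 1))! : ℝ) = ((r + 1) * k)! *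
      ((∏ j ∈ Finset.range r, ((r + 1) * k + j + 1 : ℝ)) * ((r + 1) * (k + 1))) := by
    rw [show (r + 1) * (k + 1) = (r + 1) * k + (r + 1) by ring, ← Nat.factorial_mul_ascFactorial,
      Nat.ascFactorial_eq_prod_range, Finset.prod_range_succ]
    push_cast
    congr 2
    · exact Finset.prod_congr rfl fun j _ => by ring
    · ring
  have h2 : ((r * (k + 1) + 1)! : ℝ) = (r * k + 1)! *
      ∏ j ∈ Finset.range r, (r * k + j + 2 : ℝ) := by
    rw [show r * (k + 1) + 1 = (r * k + 1) + r by ring, ← Nat.factorial_mul_ascFactorial,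
      Nat.ascFactorial_eq_prod_range]
    push_cast
    congr 1
    exact Finset.prod_congr rfl fun j _ => by ring
  have h3 : ∏ j ∈ Finset.range r, (r * k + j + 2 : ℝ) ≠ 0 :=
    Finset.prod_ne_zero_iff.2 fun j _ => by positivity
  rw [fussCatalan_eq_factorial, fussCatalan_eq_factorial, h1, h2, Nat.factorial_succ,
    Finset.prod_div_distrib]
  push_cast
  field_simp

/-- The ratio of consecutive Fuss-Catalan numbers is a rational function of `k`. Making its linear
factors monic leaves the constant `(r + 1) ^ (r + 1) / r ^ r` and `r` quotients of the type in
`isPosMomentSeq_beta`, with `(j + 1) / (r + 1) < (j + 2) / r`. -/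
theorem fussCatalan_eq_prod {r : ℕ} (hr : r ≠ 0) (k : ℕ) :
    fussCatalan (r + 1) k = (((r + 1 : ℝ) ^ (r + 1)) / (r : ℝ) ^ r) ^ k *
      ∏ j ∈ Finset.range r, ∏ i ∈ Finset.range k,
        ((j + 1) / (r + 1) + i : ℝ) / ((j + 2) / r + i) := by
  have hrR : (r : ℝ) ≠ 0 := by exact_mod_cast hr
  induction k with
  | zero => simp [fussCatalan]
  | succ k ih =>
    have h1 : ∀ j : ℕ, ((j + 1) / (r + 1) + k : ℝ) / ((j + 2) / r + k) =
        (r / (r + 1)) * (((r + 1) * k + j + 1 : ℝ) / (r * k + j + 2)) := by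
      intro j
      have : (j + 2 : ℝ) / r + k = (r * k + j + 2) / r := by field_simp; ring
      have h0 : (r * k + j + 2 : ℝ) ≠ 0 := by positivity
      rw [this]
      field_simp
      ring
    simp only [Finset.prod_range_succ _ k, Finset.prod_mul_distrib, h1]
    rw [fussCatalan_succ, ih, Finset.prod_const, Finset.card_range, pow_succ _ k, div_pow]
    field_simp
    rw [div_pow, pow_succ]
    field_simp

theorem isPosMomentSeq_fussCatalan {r : ℕ} (hr : r ≠ 0) :
    IsPosMomentSeq fun k => fussCatalan (r + 1) k := by
  simp only [fussCatalan_eq_prod hr]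
  refine (isPosMomentSeq_pow (by positivity)).mul (IsPosMomentSeq.prod _ _ fun j _ => ?_)
  have hr0 : (0 : ℝ) < r := by positivity
  refine isPosMomentSeq_beta (by positivity) ?_
  rw [div_lt_div_iff₀ (by positivity) hr0]
  nlinarith [(Nat.cast_nonneg j : (0 : ℝ) ≤ j)]

/-- A symmetric measure whose even moments are given. -/
theorem IsPosMomentSeq.exists_symmetric {m : ℕ → ℝ} (h : IsPosMomentSeq m) :
    ∃ μ : Measure ℝ, IsCompactProb μ ∧
      ∀ n : ℕ, ∫ x, x ^ n ∂μ = if Even n then m (n / 2) else 0 := by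
  obtain ⟨ν, M, hν, hM, hm⟩ := h
  have hae : ∀ t : ℝ, |t| = 1 → ∀ᵐ x ∂(ν.map fun x => t * √x), |x| ≤ √M := by
    intro t ht
    rw [ae_map_iff (by fun_prop) (measurableSet_le (by fun_prop) (by fun_prop))]
    filter_upwards [hM] with x hx
    rw [abs_mul, ht, one_mul, abs_of_nonneg (Real.sqrt_nonneg x)]
    exact Real.sqrt_le_sqrt hx.2
  have hprob : ∀ t : ℝ, IsProbabilityMeasure (ν.map fun x => t * √x) := fun t =>
    Measure.isProbabilityMeasure_map (by fun_prop)
  have hcomp : ∀ t : ℝ, |t| = 1 → IsCompactProb (ν.map fun x => t * √x) := fun t ht =>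
    isCompactProb_iff.2 ⟨hprob t, √M, hae t ht⟩
  have h1 := hprob 1
  have h2 := hprob (-1)
  have hint : ∀ (t : ℝ) (n : ℕ), ∫ x, x ^ n ∂(ν.map fun x => t * √x) =
      t ^ n * ∫ x, √x ^ n ∂ν := by
    intro t n
    rw [integral_map (by fun_prop) (by fun_prop), ← integral_const_mul]
    simp only [mul_pow]
  -- The average of the images of `ν` under `√x` and `-√x`: odd moments cancel, and the moment of
  -- order `2 * k` is the `k`-th moment of `ν`.
  refine ⟨(2⁻¹ : ENNReal) • ((ν.map fun x => 1 * √x) + ν.map fun x => (-1) * √x),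
    isCompactProb_iff.2 ⟨⟨?_⟩, √M, ?_⟩, fun n => ?_⟩
  · rw [Measure.smul_apply, Measure.add_apply, measure_univ, measure_univ, one_add_one_eq_two,
      smul_eq_mul, ENNReal.inv_mul_cancel two_ne_zero ENNReal.ofNat_ne_top]
  · refine Measure.ae_smul_measure ?_ _
    rw [ae_add_measure_iff]
    exact ⟨hae 1 (by simp), hae (-1) (by simp)⟩
  · rw [integral_smul_measure, integral_add_measure
      ((hcomp 1 (by simp)).integrable_of_continuous (by fun_prop))
      ((hcomp (-1) (by simp)).integrable_of_continuous (by fun_prop)), hint, hint]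
    rcases Nat.even_or_odd' n with ⟨k, rfl | rfl⟩
    · rw [if_pos (by simp), Nat.mul_div_cancel_left k two_pos, ← hm]
      have : ∫ x, √x ^ (2 * k) ∂ν = ∫ x, x ^ k ∂ν := by
        refine integral_congr_ae ?_
        filter_upwards [hM] with x hx
        rw [pow_mul, Real.sq_sqrt hx.1]
      rw [this]
      simp
      ring
    · rw [if_neg (by simp)]
      simp [pow_succ, pow_mul]

end Stieltjes

/-- The semicircular law of order `p` exists. -/
theorem exists_isSemicircularLaw {p : ℕ} (hp2 : 2 ≤ p) : ∃ μ, IsSemicircularLaw p μ := by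
  obtain ⟨r, rfl⟩ : ∃ r, p = r + 1 := ⟨p - 1, by omega⟩
  exact (isPosMomentSeq_fussCatalan (r := r) (by omega)).exists_symmetric

end TensorFree

/-! ### Conclusion -/

theorem mainTheorem8 (p : ℕ) (hp : Even p) (hp2 : 2 ≤ p) :
    (∃! μ : MeasureTheory.Measure ℝ, TensorFree.IsSemicircularLaw p μ) ∧
      ∀ μ : MeasureTheory.Measure ℝ, TensorFree.IsSemicircularLaw p μ →
        ∀ ρ : MeasureTheory.Measure ℝ, TensorFree.IsTensorFreeConvolution p μ μ ρ ↔
          ρ = μ.map (fun x : ℝ => √2 * x) := by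
  open TensorFree in
  have hp0 : p ≠ 0 := by omega
  refine ⟨?_, fun μ hμ ρ => ?_⟩
  · obtain ⟨μ, hμ⟩ := exists_isSemicircularLaw hp2
    exact ⟨μ, hμ, fun ν hν => hν.1.ext_of_moments hμ.1 fun n => by rw [hμ.2, hν.2]⟩
  have hlaw : ∀ φ : Distribution p (Fin 2), φ.IsFree →
      (∀ i n, (φ.marginal i).moment n = semicircularMoment p n) →
      φ.sum.HasLaw (μ.map fun x : ℝ => √2 * x) := by
    intro φ hφ hm n
    refine ⟨(hμ.1.map_mul _).integrable_of_continuous (by fun_prop), ?_⟩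
    rw [hφ.moment_sum hp hp0 hm, integral_pow_map_mul, hμ.2]
    rfl
  have hpair : ∀ φ : Distribution p (Fin 2), IsFreePair p μ μ φ →
      φ.sum.HasLaw (μ.map fun x : ℝ => √2 * x) := by
    rintro φ ⟨hφ, h0, h1⟩
    refine hlaw φ hφ fun i n => ?_
    fin_cases i
    · exact (h0 n).2.symm.trans (hμ.2 n)
    · exact (h1 n).2.symm.trans (hμ.2 n)
  constructor
  -- A single free pair already fixes all moments of `ρ`, and compact support then fixes `ρ`.
  · rintro ⟨hρ, ⟨φ, hφ⟩, hsum⟩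
    refine hρ.ext_of_moments (hμ.1.map_mul _) fun n => ?_
    rw [(hsum φ hφ n).2, (hpair φ hφ n).2]
  · rintro rfl
    refine ⟨hμ.1.map_mul _, ?_, hpair⟩
    obtain ⟨φ, hφ, hcum⟩ := exists_isFree hp hp0 (Fin 2)
    have hmarg : ∀ i, (φ.marginal i).HasLaw μ := fun i n =>
      ⟨hμ.1.integrable_of_continuous (by fun_prop), by
        rw [Distribution.moment_of_rootedCum hp hp0 (hcum i), hμ.2]; rfl⟩
    exact ⟨φ, hφ, hmarg 0, hmarg 1⟩
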